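/- For an open bounded convex set $K\subset\mathbb R^n$, $n\ge 1$, and distinct points $p,q\in K$, the Funk distance is $d_K(p,q)=\log\frac{|p-b|}{|q-b|}$, where $b$ is the point at which the half-line from $p$ through $q$ meets $\partial K$, and $d_K(p,p)=0$. Let $B_K(p,R)=\{z\in K: d_K(p,z)\le R\}$ be the forward ball, $K^p=\{\xi\in\mathbb R^n:\langle \xi,x-p\rangle\le 1\text{ for all }x\in K\}$ the polar of $K$ with respect to $p$, $|\cdot|$ Lebesgue measure, $\omega_n$ the volume of the Euclidean unit ball of $\mathbb R^n$, and $\mathrm{vol}_K(U)=\frac1{\omega_n}\int_U|K^p|\,dp$ the Holmes--Thompson volume of a Borel set $U\subset K$ in the Funk geometry of $K$. Let $\Delta_n=\{x\in\mathbb R^n: x_1,\dots,x_n>0,\ x_1+\dots+x_n<1\}$ be the standard simplex, $\Delta_n(R)$ its forward ball of radius $R$ centered at its barycenter $\left(\frac1{n+1},\dots,\frac1{n+1}\right)$, and $V_{\Delta_n}(R)=\omega_n\,\mathrm{vol}_{\Delta_n}(\Delta_n(R))$. Then, for every $n\ge1$ and $R>0$, $V_{\Delta_n}(R)$ is finite,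 the forward ball of radius $R$ centered at the barycenter of any nondegenerate open simplex in $\mathbb R^n$ has Holmes--Thompson volume $\frac1{\omega_n}V_{\Delta_n}(R)$ in the Funk geometry of that simplex, and $$V_{\Delta_n}(R)=\frac{n+1}{n!}\int_{\Delta_n(R)}\frac{dx_1\cdots dx_n}{x_1\cdots x_n},$$ the integral being finite. For $n\ge2$ and $R>0$, $V_{\Delta_n}$ is differentiable at $R$ and $$V'_{\Delta_n}(R)=\frac{n+1}{n}\,\frac{1}{1-\frac{e^{-R}}{n+1}}\,V_{\Delta_{n-1}}\!\left(R+\log\left(1+\frac1n-\frac1n e^{-R}\right)\right).$$ For every $n\ge 1$, $$V_{\Delta_n}(R)=\frac{(n+1)!}{(n!)^2}R^n\left(1+n\log(n+1)R^{-1}+o(R^{-1})\right)\qquad (R\to\infty),$$ $$V_{\Delta_n}(R)=\frac{(n+1)^{n+1}}{(n!)^2}\left(R^n-\frac n2R^{n+1}+o(R^{n+1})\right)\qquad (R\to0^+).$$ -/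

import Mathlib

open MeasureTheory Filter Topology Asymptotics

noncomputable section

namespace FunkSimplex

/-- `ℝⁿ` with its Euclidean structure and Lebesgue measure. -/
abbrev E (n : ℕ) : Type := EuclideanSpace ℝ (Fin n)

/-- For an open bounded convex set `K`, a point `p ∈ K` and `v ≠ 0`, this is the unique `t > 0`
with `p + t v ∈ ∂K`. -/
def exitTime {n : ℕ} (K : Set (E n)) (p v : E n) : ℝ :=
  sInf {t : ℝ | 0 < t ∧ p + t • v ∈ frontier K}

/-- The point where the half-line from `p` through `q` meets `∂K`. -/
def exitPoint {n : ℕ} (K : Set (E n)) (p q : E n) : E n :=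
  p + exitTime K p (q - p) • (q - p)

open Classical in
/-- The Funk (weak) distance `log (pb / qb)`, where `b` is the point at which the half-line
from `p` through `q` meets `∂K`; it vanishes for `p = q`. -/
def funkDist {n : ℕ} (K : Set (E n)) (p q : E n) : ℝ :=
  if p = q then 0
  else Real.log (dist p (exitPoint K p q) / dist q (exitPoint K p q))

/-- The forward Funk ball with center `p` and radius `R`. -/
def funkBall {n : ℕ} (K : Set (E n)) (p : E n) (R : ℝ) : Set (E n) :=
  {z | z ∈ K ∧ funkDist K p z ≤ R}

/-- The (one-sided) polar `(K - p)°` of `K` with respect to `p`, the dual of `ℝⁿ` being identified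
with `ℝⁿ` through the standard coordinates. -/
def polarAt {n : ℕ} (K : Set (E n)) (p : E n) : Set (E n) :=
  {ξ | ∀ x ∈ K, inner ℝ ξ (x - p) ≤ 1}

/-- The volume `ω_n` of the Euclidean unit ball. -/
def unitBallVolume (n : ℕ) : ENNReal := volume (Metric.ball (0 : E n) 1)

/-- The Holmes--Thompson volume of `U ⊆ K` in the Funk geometry of `K`. -/
def holmesThompson {n : ℕ} (K U : Set (E n)) : ENNReal :=
  ∫⁻ p in U, volume (polarAt K p) / unitBallVolume n

/-- The standard open simplex, the interior of the convex hull of `0, e_1, …, e_n`. -/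
def stdSimplex (n : ℕ) : Set (E n) :=
  {x | (∀ i, 0 < x i) ∧ ∑ i, x i < 1}

/-- The barycenter of the standard simplex. -/
def stdBarycenter (n : ℕ) : E n :=
  WithLp.toLp 2 (fun _ => 1 / ((n : ℝ) + 1))

/-- The forward Funk ball `Δ_n(R)` of the standard simplex around its barycenter. -/
def simplexBall (n : ℕ) (R : ℝ) : Set (E n) :=
  funkBall (stdSimplex n) (stdBarycenter n) R

/-- `V_{Δ_n}(R)`: the Holmes--Thompson volume of `Δ_n(R)` multiplied by `ω_n`. -/
def simplexVolume (n : ℕ) (R : ℝ) : ℝ :=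
  (unitBallVolume n * holmesThompson (stdSimplex n) (simplexBall n R)).toReal

end FunkSimplex

end

noncomputable section

namespace FunkSimplex

/-! ### Comparing functions through their derivatives -/

/-! With x₀ = 1 - ∑ xᵢ, the polar of the simplex at x is an affine preimage of the closed simplex,
so its volume is 1 / (n! x₀ x₁ ⋯ xₙ) (`volume_polarAt_stdSimplex`). A Funk ball is the part in K of
a homothetic copy of the closure of K with ratio 1 - e^{-R} about the center (`funkDist_le_iff`).
Around the barycenter it is therefore {x₀, …, xₙ ≥ c} with c = e^{-R} / (n + 1). Inserting 1 = x₀ +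
⋯ + xₙ in the numerator splits the density into n + 1 terms with equal integrals, which is the
integral formula (`lintegral_invTrunc_mul`).

The integral of 1 / ∏ yᵢ over {yᵢ ≥ c, ∑ yᵢ ≤ S} obeys a recursion in n: multiply by ∑ yⱼ / ∑ yᵢ and
use the total sum as a variable (`truncIntegral_succ`). By homogeneity it depends only on S / c = n
+ τ, and as a function of τ it is `profile` (`truncIntegral_eq`). For the ball, τ = (n + 1)(e^R -
1).

Everything else is one-variable calculus. The recursion `profile (n + 1)' = (n + 1) / (n + 1 + τ) *
profile n` has the same argument on both sides; the shifted radius in the differential equation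
appears only on returning to R. Both asymptotics follow by induction, comparing derivatives: in τ
near 0, and in s = log τ near infinity, where the factor becomes n + 1 up to an exponentially small
error. Affine invariance (`funkBall_image`, `holmesThompson_image`) gives all other simplices. -/

lemma isLittleO_atTop_of_deriv {f f' g g' : ℝ → ℝ} (hf : ∀ᶠ x in atTop, HasDerivAt f (f' x) x)
    (hg : ∀ᶠ x in atTop, HasDerivAt g (g' x) x) (hpos : ∀ᶠ x in atTop, 0 < g' x)
    (htop : Tendsto g atTop atTop) (h : f' =o[atTop] g') : f =o[atTop] g := by
  rw [isLittleO_iff]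
  intro ε hε
  obtain ⟨a, ha⟩ := eventually_atTop.1
    (hf.and (hg.and (hpos.and (isLittleO_iff.1 h (half_pos hε)))))
  filter_upwards [eventually_gt_atTop a,
    -- This threshold lets half of ε * |g b| absorb the boundary terms at `a`; Cauchy's mean value
    -- theorem on [a, b] supplies the other half.
    htop.eventually_ge_atTop (2 / ε * (|f a| + ε / 2 * |g a|)),
    htop.eventually_ge_atTop 0] with b hab hb hb0
  obtain ⟨c, hc, hcc⟩ := exists_ratio_hasDerivAt_eq_ratio_slope f f' hab
    (fun x hx => (ha x hx.1).1.continuousAt.continuousWithinAt)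
    (fun x hx => (ha x hx.1.le).1) g g'
    (fun x hx => (ha x hx.1).2.1.continuousAt.continuousWithinAt)
    (fun x hx => (ha x hx.1.le).2.1)
  obtain ⟨-, -, hp, hl⟩ := ha c hc.1.le
  rw [Real.norm_eq_abs, Real.norm_eq_abs, abs_of_pos hp] at hl
  have key : |f b - f a| ≤ ε / 2 * |g b - g a| := by
    have h1 : |f b - f a| * g' c = |g b - g a| * |f' c| := by
      rw [← abs_mul, hcc, abs_mul, abs_of_pos hp]
    have h2 : |f b - f a| * g' c ≤ (ε / 2 * |g b - g a|) * g' c := by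
      rw [h1]; nlinarith [abs_nonneg (g b - g a)]
    exact le_of_mul_le_mul_right h2 hp
  have h3 : |f b| ≤ |f b - f a| + |f a| := by
    simpa using abs_add_le (f b - f a) (f a)
  have h4 : |g b - g a| ≤ |g b| + |g a| := abs_sub _ _
  have h5 : |f a| + ε / 2 * |g a| ≤ ε / 2 * |g b| := by
    rw [abs_of_nonneg hb0]
    have := mul_le_mul_of_nonneg_left hb (half_pos hε).le
    have e : ε / 2 * (2 / ε * (|f a| + ε / 2 * |g a|)) = |f a| + ε / 2 * |g a| := by
      field_simp
    linarith
  rw [Real.norm_eq_abs, Real.norm_eq_abs]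
  nlinarith [mul_le_mul_of_nonneg_left h4 (half_pos hε).le]

lemma isLittleO_zero_of_deriv {f f' : ℝ → ℝ} {k : ℕ} (hf : ∀ x, 0 ≤ x → HasDerivAt f (f' x) x)
    (h0 : f 0 = 0) (h : f' =o[𝓝[>] 0] fun x => x ^ k) : f =o[𝓝[>] 0] fun x => x ^ (k + 1) := by
  rw [isLittleO_iff]
  intro ε hε
  have h1 := isLittleO_iff.1 h hε
  obtain ⟨δ, hδ, hsub⟩ := mem_nhdsGT_iff_exists_Ioo_subset.1 h1
  filter_upwards [Ioo_mem_nhdsGT hδ] with b hb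
  obtain ⟨c, hc, hcc⟩ := exists_hasDerivAt_eq_slope f f' hb.1
    (fun x hx => (hf x hx.1).continuousAt.continuousWithinAt) (fun x hx => hf x hx.1.le)
  have h2 : ‖f' c‖ ≤ ε * ‖c ^ k‖ := hsub ⟨hc.1, hc.2.trans hb.2⟩
  have hb0 : 0 < b := hb.1
  have h3 : f b = f' c * b := by
    rw [hcc, h0, sub_zero, sub_zero, div_mul_cancel₀ _ hb0.ne']
  have h4 : ‖c ^ k‖ ≤ ‖b ^ k‖ := by
    rw [norm_pow, norm_pow, Real.norm_of_nonneg hc.1.le, Real.norm_of_nonneg hb0.le]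
    exact pow_le_pow_left₀ hc.1.le hc.2.le k
  rw [h3, norm_mul, pow_succ, norm_mul, ← mul_assoc]
  gcongr
  exact h2.trans (by gcongr)

/-- Factor a^k - b^k = (a - b) ∑ a^i b^(k-1-i) and divide by b^(k-1): each of the k summands tends
to 1. For k = 0 the truncated exponent is harmless, both sides being 0. It transfers expansions from
e^R - 1 or log τ to R. -/
lemma tendsto_pow_sub_pow_div {ι : Type*} {l : Filter ι} {a b d : ι → ℝ} {L : ℝ} (k : ℕ)
    (hb : ∀ᶠ x in l, b x ≠ 0) (hab : Tendsto (fun x => a x / b x) l (𝓝 1))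
    (hd : Tendsto (fun x => (a x - b x) / d x) l (𝓝 L)) :
    Tendsto (fun x => (a x ^ k - b x ^ k) / (d x * b x ^ (k - 1))) l (𝓝 (k * L)) := by
  have h1 : Tendsto (fun x => (a x - b x) / d x * ∑ i ∈ Finset.range k, (a x / b x) ^ i) l
      (𝓝 (L * ∑ i ∈ Finset.range k, (1 : ℝ) ^ i)) :=
    hd.mul (tendsto_finsetSum _ fun i _ => hab.pow i)
  have h2 : L * ∑ i ∈ Finset.range k, (1 : ℝ) ^ i = k * L := by simp [mul_comm]
  rw [h2] at h1
  refine h1.congr' ?_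
  filter_upwards [hb] with x hx
  have h3 : ∑ i ∈ Finset.range k, (a x / b x) ^ i
      = (∑ i ∈ Finset.range k, a x ^ i * b x ^ (k - 1 - i)) / b x ^ (k - 1) := by
    rw [Finset.sum_div]
    refine Finset.sum_congr rfl fun i hi => ?_
    have : k - 1 = (k - 1 - i) + i := by have := Finset.mem_range.1 hi; omega
    rw [div_pow, div_eq_div_iff (pow_ne_zero _ hx) (pow_ne_zero _ hx)]
    conv_lhs => rw [this, pow_add]
    ring
  rw [h3, ← geom_sum₂_mul (a x) (b x) k]
  rw [div_mul_div_comm, mul_comm (a x - b x)]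

/-! ### The volume profile -/

/-- The volume of a Funk ball of the simplex, normalized and written in a parameter in which the
recursive differential equation has no shift. -/
def profile : ℕ → ℝ → ℝ
  | 0, _ => 1
  | n + 1, τ => ∫ t in (0 : ℝ)..τ, ((n : ℝ) + 1) / ((n : ℝ) + 1 + |t|) * profile n t

lemma continuous_profile (n : ℕ) : Continuous (profile n) := by
  induction n with
  | zero => exact continuous_const
  | succ n ih =>
    refine intervalIntegral.continuous_primitive (fun a b => ?_) 0
    refine Continuous.intervalIntegrable ?_ _ _
    exact (continuous_const.div (by fun_prop) fun t => by positivity).mul ih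

lemma hasDerivAt_profile (n : ℕ) (τ : ℝ) :
    HasDerivAt (profile (n + 1)) (((n : ℝ) + 1) / ((n : ℝ) + 1 + |τ|) * profile n τ) τ := by
  have hc : Continuous fun t : ℝ => ((n : ℝ) + 1) / ((n : ℝ) + 1 + |t|) * profile n t :=
    (continuous_const.div (by fun_prop) fun t => by positivity).mul (continuous_profile n)
  exact intervalIntegral.integral_hasDerivAt_right (hc.intervalIntegrable _ _)
    (hc.stronglyMeasurableAtFilter _ _) hc.continuousAt

lemma profile_succ_zero (n : ℕ) : profile (n + 1) 0 = 0 := by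
  simp [profile]

lemma profile_nonneg (n : ℕ) {τ : ℝ} (hτ : 0 ≤ τ) : 0 ≤ profile n τ := by
  induction n generalizing τ with
  | zero => exact zero_le_one
  | succ n ih =>
    refine intervalIntegral.integral_nonneg hτ fun t ht => mul_nonneg (by positivity) (ih ht.1)

lemma profile_one {τ : ℝ} (hτ : 0 ≤ τ) : profile 1 τ = Real.log (1 + τ) := by
  have h := intervalIntegral.integral_eq_sub_of_hasDerivAt (a := 0) (b := τ)
    (f := fun t => Real.log (1 + t)) (f' := fun t => ((0 : ℕ) + 1 : ℝ) / ((0 : ℕ) + 1 + |t|) * 1)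
    (fun t ht => ?_) ?_
  · simpa [profile] using h
  · rw [Set.uIcc_of_le hτ] at ht
    have h1 : (1 + t : ℝ) ≠ 0 := by linarith [ht.1]
    have := ((hasDerivAt_id t).const_add 1).log h1
    simpa [abs_of_nonneg ht.1] using this
  · refine Continuous.intervalIntegrable ?_ _ _
    exact (continuous_const.div (by fun_prop) fun t => by positivity).mul continuous_const

lemma profile_isLittleO_zero (n : ℕ) :
    (fun τ => profile n τ - (τ ^ n - (n : ℝ) / (n + 1) * τ ^ (n + 1)) / n.factorial)
      =o[𝓝[>] 0] fun τ => τ ^ (n + 1) := by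
  induction n with
  | zero => simp [profile]
  | succ n ih =>
    refine isLittleO_zero_of_deriv (k := n + 1) (f' := fun τ =>
      ((n : ℝ) + 1) / ((n : ℝ) + 1 + |τ|) * profile n τ - (τ ^ n - τ ^ (n + 1)) / n.factorial)
      (fun τ hτ => ?_) ?_ ?_
    · refine (hasDerivAt_profile n τ).sub ?_
      have h := (((hasDerivAt_pow (n + 1) τ).sub
        ((hasDerivAt_pow (n + 1 + 1) τ).const_mul (((n + 1 : ℕ) : ℝ) / ((n + 1 : ℕ) + 1)))).div_const
        ((n + 1).factorial : ℝ))
      refine h.congr_deriv ?_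
      have : (n.factorial : ℝ) ≠ 0 := by positivity
      have h2 : (n : ℝ) + 1 + 1 ≠ 0 := by positivity
      push_cast [Nat.factorial_succ]
      field_simp
    · simp [profile_succ_zero]
    -- The difference of derivatives is the weight times the inductive error (`h1`) plus the effect
    -- of the weight on the polynomial, which is exactly τ^(n+2) / (n! (n + 1 + τ)) for τ > 0
    -- (`h2`).
    · have h1 : (fun τ : ℝ => ((n : ℝ) + 1) / ((n : ℝ) + 1 + |τ|) *
          (profile n τ - (τ ^ n - (n : ℝ) / (n + 1) * τ ^ (n + 1)) / n.factorial))
          =o[𝓝[>] 0] fun τ => τ ^ (n + 1) := by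
        have hb : (fun τ : ℝ => ((n : ℝ) + 1) / ((n : ℝ) + 1 + |τ|)) =O[𝓝[>] 0]
            fun _ => (1 : ℝ) := by
          refine IsBigO.of_bound 1 (Eventually.of_forall fun τ => ?_)
          rw [Real.norm_of_nonneg (by positivity), norm_one, one_mul]
          exact div_le_one_of_le₀ (by linarith [abs_nonneg τ]) (by positivity)
        simpa using hb.mul_isLittleO ih
      have h2 : (fun τ : ℝ => τ ^ (n + 2) / (n.factorial * ((n : ℝ) + 1 + |τ|)))
          =o[𝓝[>] 0] fun τ => τ ^ (n + 1) := by
        have hb : (fun τ : ℝ => τ ^ (n + 2) / (n.factorial * ((n : ℝ) + 1 + |τ|))) =O[𝓝[>] 0]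
            fun τ => τ ^ (n + 2) := by
          refine IsBigO.of_bound 1 (Eventually.of_forall fun τ => ?_)
          rw [one_mul, norm_div]
          refine div_le_self (norm_nonneg _) ?_
          rw [Real.norm_of_nonneg (by positivity)]
          have : (1 : ℝ) ≤ n.factorial := by exact_mod_cast Nat.factorial_pos n
          nlinarith [abs_nonneg τ, (Nat.cast_nonneg n : (0 : ℝ) ≤ n)]
        exact hb.trans_isLittleO ((isLittleO_pow_pow (by omega)).mono nhdsWithin_le_nhds)
      refine (h1.add h2).congr' ?_ EventuallyEq.rfl
      filter_upwards [self_mem_nhdsWithin] with τ (hτ : 0 < τ)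
      rw [abs_of_pos hτ]
      have : (n.factorial : ℝ) ≠ 0 := by positivity
      have h3 : (n : ℝ) + 1 + τ ≠ 0 := by positivity
      field_simp
      ring

/-- In s = log τ the derivative of the left function is (n + 2) e^s / (n + 2 + e^s) times the
previous one. The weight differs from n + 2 by O(e^{-s}), which beats the polynomial growth, so
s^(n+2) results with no term of degree n + 1. The base case is log(1 + e^s) - s → 0. -/
lemma profile_exp_isLittleO (n : ℕ) :
    (fun s : ℝ => profile (n + 1) (Real.exp s) - s ^ (n + 1)) =o[atTop] fun s => s ^ n := by
  induction n with
  | zero =>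
    simp only [pow_zero, zero_add, pow_one]
    rw [isLittleO_one_iff]
    have h : Tendsto (fun s : ℝ => Real.log (1 + Real.exp (-s))) atTop (𝓝 (Real.log (1 + 0))) := by
      refine Tendsto.log ?_ (by norm_num)
      exact tendsto_const_nhds.add (Real.tendsto_exp_neg_atTop_nhds_zero)
    simp only [add_zero, Real.log_one] at h
    refine h.congr fun s => ?_
    rw [profile_one (Real.exp_pos s).le]
    have : 1 + Real.exp s = Real.exp s * (1 + Real.exp (-s)) := by
      rw [mul_add, ← Real.exp_add]; simp [add_comm]
    rw [this, Real.log_mul (by positivity) (by positivity), Real.log_exp]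
    ring
  | succ n ih =>
    refine isLittleO_atTop_of_deriv (f' := fun s => ((n + 1 : ℕ) + 1 : ℝ) /
      (((n + 1 : ℕ) : ℝ) + 1 + |Real.exp s|) * profile (n + 1) (Real.exp s) * Real.exp s
      - ((n + 1 + 1 : ℕ) : ℝ) * s ^ (n + 1)) (g' := fun s => ((n + 1 : ℕ) : ℝ) * s ^ n) ?_ ?_ ?_ ?_ ?_
    · refine Eventually.of_forall fun s => ?_
      exact ((hasDerivAt_profile (n + 1) _).comp s (Real.hasDerivAt_exp s)).sub
        (hasDerivAt_pow (n + 1 + 1) s)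
    · exact Eventually.of_forall fun s => hasDerivAt_pow (n + 1) s
    · filter_upwards [eventually_gt_atTop 0] with s hs
      positivity
    · exact tendsto_pow_atTop (by omega)
    · have hO : (fun s : ℝ => profile (n + 1) (Real.exp s)) =O[atTop] fun s => s ^ (n + 1) := by
        have h1 : (fun s : ℝ => s ^ n) =O[atTop] fun s : ℝ => s ^ (n + 1) :=
          (isLittleO_pow_pow_atTop_of_lt (by omega)).isBigO
        simpa using (ih.isBigO.trans h1).add (isBigO_refl (fun s : ℝ => s ^ (n + 1)) atTop)
      have hE : (fun s : ℝ => ((n : ℝ) + 2) / ((n : ℝ) + 2 + Real.exp s)) =O[atTop]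
          fun s => Real.exp (-s) := by
        refine IsBigO.of_bound ((n : ℝ) + 2) (Eventually.of_forall fun s => ?_)
        rw [Real.norm_of_nonneg (by positivity), Real.norm_of_nonneg (by positivity),
          Real.exp_neg, ← div_eq_mul_inv]
        gcongr
        linarith [(Nat.cast_nonneg n : (0 : ℝ) ≤ n)]
      have hP : (fun s : ℝ => ((n : ℝ) + 2) / ((n : ℝ) + 2 + Real.exp s) *
          profile (n + 1) (Real.exp s)) =o[atTop] fun s => s ^ n := by
        refine (hE.mul hO).trans_isLittleO ?_
        have h0 : (fun s : ℝ => Real.exp (-s) * s) =o[atTop] fun _ => (1 : ℝ) := by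
          rw [isLittleO_one_iff]
          simpa [mul_comm] using Real.tendsto_pow_mul_exp_neg_atTop_nhds_zero 1
        have := h0.mul_isBigO (isBigO_refl (fun s : ℝ => s ^ n) atTop)
        simpa [mul_assoc, pow_succ', mul_comm, mul_left_comm] using this
      refine IsLittleO.const_mul_right (by positivity) ?_
      refine ((ih.const_mul_left ((n : ℝ) + 2)).sub (hP.const_mul_left ((n : ℝ) + 2))).congr'
        (Eventually.of_forall fun s => ?_) EventuallyEq.rfl
      have h3 : (n : ℝ) + 2 + Real.exp s ≠ 0 := by positivity
      have h4 : (n : ℝ) + 1 + 1 + Real.exp s ≠ 0 := by positivity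
      push_cast
      rw [abs_of_pos (Real.exp_pos s)]
      field_simp
      ring

/-! ### The profile as a function of the radius -/

lemma hasDerivAt_profile_radius (m : ℕ) {R : ℝ} (hR : 0 < R) :
    HasDerivAt (fun R => profile (m + 1) ((((m + 1 : ℕ) : ℝ) + 1) * (Real.exp R - 1)))
      (((m : ℝ) + 1) / (1 - Real.exp (-R) / (((m + 1 : ℕ) : ℝ) + 1)) *
        profile m (((m : ℝ) + 1) * (Real.exp (R + Real.log (1 + 1 / ((m + 1 : ℕ) : ℝ)
          - 1 / ((m + 1 : ℕ) : ℝ) * Real.exp (-R))) - 1))) R := by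
  have hE : 1 < Real.exp R := Real.one_lt_exp_iff.2 hR
  have hE' : Real.exp (-R) < 1 := by rw [Real.exp_lt_one_iff]; linarith
  have hee : Real.exp R * Real.exp (-R) = 1 := by rw [← Real.exp_add]; simp
  have h := (hasDerivAt_profile m ((((m + 1 : ℕ) : ℝ) + 1) * (Real.exp R - 1))).comp R
    (((Real.hasDerivAt_exp R).sub_const 1).const_mul (((m + 1 : ℕ) : ℝ) + 1))
  have hm : (0 : ℝ) < (m : ℝ) + 1 := by positivity
  -- The shifted radius R' is the solution of n (e^{R'} - 1) = (n + 1)(e^R - 1) with n = m + 1: both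
  -- dimensions then have the same parameter τ.
  have harg : ((m : ℝ) + 1) * (Real.exp (R + Real.log (1 + 1 / ((m + 1 : ℕ) : ℝ)
      - 1 / ((m + 1 : ℕ) : ℝ) * Real.exp (-R))) - 1)
      = (((m + 1 : ℕ) : ℝ) + 1) * (Real.exp R - 1) := by
    have hpos : 0 < 1 + 1 / ((m + 1 : ℕ) : ℝ) - 1 / ((m + 1 : ℕ) : ℝ) * Real.exp (-R) := by
      have : 0 < 1 / ((m + 1 : ℕ) : ℝ) := by positivity
      nlinarith
    rw [Real.exp_add, Real.exp_log hpos]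
    push_cast
    field_simp
    linear_combination -hee
  rw [harg]
  refine h.congr_deriv ?_
  have h0 : 0 ≤ (((m + 1 : ℕ) : ℝ) + 1) * (Real.exp R - 1) := by
    have : 0 < Real.exp R - 1 := by linarith
    positivity
  rw [abs_of_nonneg h0, mul_right_comm]
  symm
  congr 1
  have hd : 0 < 1 - Real.exp (-R) / (((m + 1 : ℕ) : ℝ) + 1) := by
    rw [sub_pos, div_lt_one (by positivity)]
    push_cast
    linarith
  have hd2 : 0 < (m : ℝ) + 1 + (((m + 1 : ℕ) : ℝ) + 1) * (Real.exp R - 1) := by linarith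
  rw [div_mul_eq_mul_div, div_eq_div_iff hd.ne' hd2.ne']
  have hm2 : (m : ℝ) + 1 + 1 ≠ 0 := by positivity
  push_cast
  field_simp
  linear_combination hee

lemma profile_radius_isLittleO_zero (n : ℕ) :
    (fun R : ℝ => n.factorial / ((n : ℝ) + 1) ^ n * profile n (((n : ℝ) + 1) * (Real.exp R - 1))
      - (R ^ n - (n : ℝ) / 2 * R ^ (n + 1))) =o[𝓝[>] 0] fun R => R ^ (n + 1) := by
  have hslope : Tendsto (fun R : ℝ => (Real.exp R - 1) / R) (𝓝[>] 0) (𝓝 1) := by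
    have h := (hasDerivAt_iff_tendsto_slope.1 (Real.hasDerivAt_exp 0)).mono_left
      (nhdsWithin_mono 0 (fun x (hx : x ∈ Set.Ioi 0) => (Set.mem_Ioi.1 hx).ne'))
    simpa [slope_fun_def_field] using h
  have hquad : Tendsto (fun R : ℝ => (Real.exp R - 1 - R) / R ^ 2) (𝓝[>] 0) (𝓝 (1 / 2)) := by
    have h := ((Real.exp_sub_sum_range_succ_isLittleO_pow 2).mono
      (nhdsWithin_le_nhds (s := Set.Ioi 0))).tendsto_div_nhds_zero.add_const (1 / 2)
    rw [zero_add] at h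
    refine h.congr' ?_
    filter_upwards [self_mem_nhdsWithin] with R (hR : 0 < R)
    simp only [Finset.sum_range_succ, Finset.sum_range_zero]
    norm_num [Nat.factorial]
    field_simp
    ring
  have hne : ∀ᶠ R : ℝ in 𝓝[>] 0, R ≠ 0 := by
    filter_upwards [self_mem_nhdsWithin] with R (hR : 0 < R) using hR.ne'
  have hpow := tendsto_pow_sub_pow_div n (a := fun R => Real.exp R - 1) (b := fun R => R)
    (d := fun R => R ^ 2) hne hslope hquad
  have hτ : Tendsto (fun R : ℝ => ((n : ℝ) + 1) * (Real.exp R - 1)) (𝓝[>] 0) (𝓝[>] 0) := by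
    refine tendsto_nhdsWithin_iff.2 ⟨?_, ?_⟩
    · have : Continuous fun R : ℝ => ((n : ℝ) + 1) * (Real.exp R - 1) := by fun_prop
      simpa using (this.tendsto 0).mono_left (nhdsWithin_le_nhds (s := Set.Ioi 0))
    · filter_upwards [self_mem_nhdsWithin] with R (hR : 0 < R)
      have : 0 < Real.exp R - 1 := by linarith [Real.one_lt_exp_iff.2 hR]
      exact Set.mem_Ioi.2 (by positivity)
  have hO : (fun R : ℝ => (((n : ℝ) + 1) * (Real.exp R - 1)) ^ (n + 1)) =O[𝓝[>] 0]
      fun R => R ^ (n + 1) := by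
    refine IsBigO.pow ?_ _
    refine IsBigO.const_mul_left ?_ _
    exact isBigO_of_div_tendsto_nhds (hne.mono fun R h h' => absurd h' h) 1 hslope
  have h1 := ((profile_isLittleO_zero n).comp_tendsto hτ).trans_isBigO hO
  -- Since e^R - 1 = R + R² / 2 + o(R²), the first power contributes n/2 and the second -n to the
  -- coefficient of R^(n+1), in total -n/2.
  have h2 : (fun R : ℝ => ((Real.exp R - 1) ^ n - n * (Real.exp R - 1) ^ (n + 1))
      - (R ^ n - (n : ℝ) / 2 * R ^ (n + 1))) =o[𝓝[>] 0] fun R => R ^ (n + 1) := by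
    rw [isLittleO_iff_tendsto' (hne.mono fun R h h' => absurd h' (pow_ne_zero _ h))]
    have h3 := (hpow.sub ((hslope.pow (n + 1)).const_mul (n : ℝ))).add_const ((n : ℝ) / 2)
    have e : (n : ℝ) * (1 / 2) - n * 1 ^ (n + 1) + n / 2 = 0 := by rw [one_pow]; ring
    rw [e] at h3
    refine h3.congr' ?_
    filter_upwards [hne] with R hR
    rcases n with _ | n
    · simp
    · simp only [Nat.add_sub_cancel, div_pow]
      field_simp
      ring
  refine ((h1.const_mul_left (n.factorial / ((n : ℝ) + 1) ^ n)).add h2).congr'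
    (Eventually.of_forall fun R => ?_) EventuallyEq.rfl
  have hf : (n.factorial : ℝ) ≠ 0 := by positivity
  have hn : (n : ℝ) + 1 ≠ 0 := by positivity
  simp only [Function.comp_def, mul_pow]
  field_simp
  ring

lemma tendsto_profile_radius_atTop (m : ℕ) :
    Tendsto (fun R : ℝ => (profile (m + 1) ((((m + 1 : ℕ) : ℝ) + 1) * (Real.exp R - 1))
      - R ^ (m + 1)) / R ^ m) atTop
      (𝓝 (((m + 1 : ℕ) : ℝ) * Real.log (((m + 1 : ℕ) : ℝ) + 1))) := by
  set N : ℝ := ((m + 1 : ℕ) : ℝ) + 1 with hN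
  have hN0 : 0 < N := by positivity
  set σ : ℝ → ℝ := fun R => Real.log (N * (Real.exp R - 1)) with hσ
  have hne : ∀ᶠ R : ℝ in atTop, R ≠ 0 := eventually_ne_atTop 0
  -- Here σ = log τ = R + log N + log(1 - e^{-R}); the constant log N is the source of the
  -- second-order term n log(n + 1).
  have hdiff : Tendsto (fun R => σ R - R) atTop (𝓝 (Real.log N)) := by
    have h : Tendsto (fun R : ℝ => Real.log (N * (1 - Real.exp (-R)))) atTop
        (𝓝 (Real.log (N * (1 - 0)))) := by
      refine Tendsto.log ?_ (by simpa using hN0.ne')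
      exact (tendsto_const_nhds.sub Real.tendsto_exp_neg_atTop_nhds_zero).const_mul N
    rw [sub_zero, mul_one] at h
    refine h.congr' ?_
    filter_upwards [eventually_gt_atTop 0] with R hR
    have h1 : Real.exp (-R) < 1 := by rw [Real.exp_lt_one_iff]; linarith
    have h2 : N * (Real.exp R - 1) = N * (1 - Real.exp (-R)) * Real.exp R := by
      rw [mul_assoc, sub_mul, ← Real.exp_add]; simp
    have h3 : 0 < 1 - Real.exp (-R) := by linarith
    rw [hσ]
    simp only
    rw [h2, Real.log_mul (x := N * (1 - Real.exp (-R))) (by positivity) (by positivity),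
      Real.log_exp]
    ring
  have hratio : Tendsto (fun R => σ R / R) atTop (𝓝 1) := by
    have h := (hdiff.mul tendsto_inv_atTop_zero).add_const 1
    rw [mul_zero, zero_add] at h
    refine h.congr' ?_
    filter_upwards [hne] with R hR
    field_simp
    ring
  have htop : Tendsto σ atTop atTop := by
    have := hdiff.add_atTop tendsto_id
    simpa using this
  have hpow := tendsto_pow_sub_pow_div (m + 1) (d := fun _ => (1 : ℝ)) hne hratio
    (by simpa using hdiff)
  have hO : (fun R => σ R ^ m) =O[atTop] fun R => R ^ m :=
    (isBigO_of_div_tendsto_nhds (hne.mono fun R h h' => absurd h' h) 1 hratio).pow m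
  have h1 := (((profile_exp_isLittleO m).comp_tendsto htop).trans_isBigO hO).tendsto_div_nhds_zero
  have h2 := h1.add hpow
  rw [zero_add] at h2
  refine h2.congr' ?_
  filter_upwards [eventually_gt_atTop 0] with R hR
  have h3 : 0 < N * (Real.exp R - 1) := by
    have : 0 < Real.exp R - 1 := by linarith [Real.one_lt_exp_iff.2 hR]
    positivity
  simp only [Function.comp_def, one_mul, Nat.add_sub_cancel]
  rw [← add_div, hσ, Real.exp_log h3]
  ring

/-! ### Iterated integrals over truncated simplices -/

/-- The indicator of `a ≤ b`. -/
def leInd (a b : ℝ) : ENNReal := if a ≤ b then 1 else 0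

/-- The function `y ↦ 1 / y` truncated below `c`. -/
def invTrunc (c y : ℝ) : ENNReal := if c ≤ y then ENNReal.ofReal y⁻¹ else 0

@[fun_prop]
lemma measurable_leInd {α : Type*} [MeasurableSpace α] {f g : α → ℝ} (hf : Measurable f)
    (hg : Measurable g) : Measurable fun x => leInd (f x) (g x) :=
  Measurable.ite (measurableSet_le hf hg) measurable_const measurable_const

@[fun_prop]
lemma measurable_invTrunc {α : Type*} [MeasurableSpace α] {f : α → ℝ} (c : ℝ)
    (hf : Measurable f) : Measurable fun x => invTrunc c (f x) :=
  Measurable.ite (measurableSet_le measurable_const hf) (by fun_prop) measurable_const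

lemma ofReal_mul_invTrunc {c : ℝ} (hc : 0 < c) (y : ℝ) :
    ENNReal.ofReal y * invTrunc c y = leInd c y := by
  unfold invTrunc leInd
  split_ifs with h
  · have hy : 0 < y := hc.trans_le h
    rw [← ENNReal.ofReal_mul hy.le, mul_inv_cancel₀ hy.ne', ENNReal.ofReal_one]
  · simp

lemma le_of_invTrunc_ne_zero {c y : ℝ} (h : invTrunc c y ≠ 0) : c ≤ y := by
  by_contra h'
  exact h (if_neg h')

lemma leInd_congr {a b a' b' : ℝ} (h : a ≤ b ↔ a' ≤ b') : leInd a b = leInd a' b' := by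
  unfold leInd
  simp only [h]

lemma lintegral_insertNth {n : ℕ} (j : Fin (n + 1)) {F : (Fin (n + 1) → ℝ) → ENNReal}
    (hF : Measurable F) :
    ∫⁻ y, F y = ∫⁻ z : Fin n → ℝ, ∫⁻ t : ℝ, F (j.insertNth t z) := by
  have h := (volume_preserving_piFinSuccAbove (fun _ : Fin (n + 1) => ℝ) j).symm
  rw [← h.lintegral_comp hF, Measure.volume_eq_prod, lintegral_prod_symm]
  · rfl
  · exact (hF.comp h.measurable).aemeasurable

lemma measurable_insertNth {n : ℕ} (j : Fin (n + 1)) :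
    Measurable fun p : (Fin n → ℝ) × ℝ => (j.insertNth p.2 p.1 : Fin (n + 1) → ℝ) := by
  refine measurable_pi_iff.2 fun i => ?_
  refine Fin.succAboveCases j ?_ (fun k => ?_) i
  · simpa using measurable_snd
  · simp only [Fin.insertNth_apply_succAbove]
    fun_prop

/-- The integral of `1 / ∏ yᵢ` over the simplex `yᵢ ≥ c`, `∑ yᵢ ≤ S`. -/
def truncIntegral (c : ℝ) (n : ℕ) (S : ℝ) : ENNReal :=
  ∫⁻ y : Fin n → ℝ, (∏ i, invTrunc c (y i)) * leInd (∑ i, y i) S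

/-- Write 1 / ∏ yᵢ = (∑ yᵢ)⁻¹ ∑ⱼ ∏_{i ≠ j} 1 / yᵢ. In the j-th term yⱼ survives only through yⱼ ≥ c,
so with t = ∑ yᵢ replacing yⱼ this constraint reads ∑_{i ≠ j} yᵢ ≤ t - c: the same integral in one
dimension less. -/
lemma truncIntegral_succ {c : ℝ} (hc : 0 < c) (n : ℕ) (S : ℝ) :
    truncIntegral c (n + 1) S =
      (n + 1 : ℕ) * ∫⁻ t : ℝ, ENNReal.ofReal t⁻¹ * leInd t S * truncIntegral c n (t - c) := by
  have hterm : ∀ j : Fin (n + 1),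
      ∫⁻ y : Fin (n + 1) → ℝ, ENNReal.ofReal (∑ i, y i)⁻¹ *
        (leInd c (y j) * ∏ i, invTrunc c (y (j.succAbove i))) * leInd (∑ i, y i) S =
      ∫⁻ t : ℝ, ENNReal.ofReal t⁻¹ * leInd t S * truncIntegral c n (t - c) := by
    intro j
    rw [lintegral_insertNth j (by fun_prop)]
    calc _ = ∫⁻ z : Fin n → ℝ, ∫⁻ t : ℝ, ENNReal.ofReal t⁻¹ *
          (leInd c (t - ∑ i, z i) * ∏ i, invTrunc c (z i)) * leInd t S := by
          refine lintegral_congr fun z => ?_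
          -- Translation of the split-off coordinate by the sum of the others makes t the total sum.
          rw [← lintegral_sub_right_eq_self _ (∑ i, z i)]
          refine lintegral_congr fun t => ?_
          simp [Fin.sum_univ_succAbove _ j]
      _ = ∫⁻ t : ℝ, ∫⁻ z : Fin n → ℝ, ENNReal.ofReal t⁻¹ *
          (leInd c (t - ∑ i, z i) * ∏ i, invTrunc c (z i)) * leInd t S := by
          refine lintegral_lintegral_swap (Measurable.aemeasurable ?_)
          simp only [Function.uncurry_def]
          fun_prop
      _ = _ := by
          refine lintegral_congr fun t => ?_
          rw [truncIntegral, ← lintegral_const_mul _ (by fun_prop)]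
          refine lintegral_congr fun z => ?_
          rw [leInd_congr (a := c) (b := t - ∑ i, z i) (a' := ∑ i, z i) (b' := t - c)
            (by constructor <;> intro h <;> linarith)]
          ring
  calc truncIntegral c (n + 1) S
      = ∫⁻ y : Fin (n + 1) → ℝ, ∑ j, ENNReal.ofReal (∑ i, y i)⁻¹ *
        (leInd c (y j) * ∏ i, invTrunc c (y (j.succAbove i))) * leInd (∑ i, y i) S := by
        refine lintegral_congr fun y => ?_
        rw [← Finset.sum_mul, ← Finset.mul_sum]
        congr 1
        have h1 : ∀ j, leInd c (y j) * ∏ i, invTrunc c (y (j.succAbove i)) =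
            ENNReal.ofReal (y j) * ∏ i, invTrunc c (y i) := by
          intro j
          rw [Fin.prod_univ_succAbove (fun i => invTrunc c (y i)) j, ← mul_assoc,
            ofReal_mul_invTrunc hc]
        simp only [h1]
        rw [← Finset.sum_mul, ← mul_assoc]
        by_cases h0 : ∏ i, invTrunc c (y i) = 0
        · simp [h0]
        · rw [← ne_eq, Finset.prod_ne_zero_iff] at h0
          have hy : ∀ i, 0 < y i := fun i =>
            hc.trans_le (le_of_invTrunc_ne_zero (h0 i (Finset.mem_univ i)))
          have hs : 0 < ∑ i, y i := Finset.sum_pos (fun i _ => hy i) Finset.univ_nonempty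
          rw [← ENNReal.ofReal_sum_of_nonneg (fun i _ => (hy i).le),
            ← ENNReal.ofReal_mul (inv_nonneg.2 hs.le), inv_mul_cancel₀ hs.ne', ENNReal.ofReal_one,
            one_mul]
    _ = _ := by
        rw [lintegral_finsetSum _ (fun j _ => by fun_prop)]
        simp only [hterm]
        simp

lemma lintegral_mul_left_real {c : ℝ} (hc : 0 < c) {F : ℝ → ENNReal} (hF : Measurable F) :
    ∫⁻ t, F t = ENNReal.ofReal c * ∫⁻ u, F (c * u) := by
  conv_lhs => rw [← Real.smul_map_volume_mul_left hc.ne']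
  rw [lintegral_smul_measure, lintegral_map hF (by fun_prop), abs_of_pos hc, smul_eq_mul]

lemma measurable_truncIntegral (c : ℝ) (n : ℕ) : Measurable (truncIntegral c n) := by
  unfold truncIntegral
  refine Measurable.lintegral_prod_right' (f := fun p : ℝ × (Fin n → ℝ) =>
    (∏ i, invTrunc c (p.2 i)) * leInd (∑ i, p.2 i) p.1) ?_
  fun_prop

lemma lintegral_Icc_ofReal {f : ℝ → ℝ} {a b : ℝ} (hab : a ≤ b) (hf : ContinuousOn f (Set.Icc a b))
    (h0 : ∀ x ∈ Set.Icc a b, 0 ≤ f x) :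
    ∫⁻ x in Set.Icc a b, ENNReal.ofReal (f x) = ENNReal.ofReal (∫ x in a..b, f x) := by
  rw [intervalIntegral.integral_of_le hab, ← integral_Icc_eq_integral_Ioc,
    ofReal_integral_eq_lintegral_ofReal (hf.integrableOn_compact isCompact_Icc)]
  exact (ae_restrict_iff' measurableSet_Icc).2 (Eventually.of_forall h0)

/-- The least possible sum is n c, so τ measures the excess in units of c. Substituting t = c (n + 1
+ u) in the recursion turns t - c into c (n + u) and (n + 1) dt / t into (n + 1) / (n + 1 + u) du.
-/
lemma truncIntegral_eq {c : ℝ} (hc : 0 < c) (n : ℕ) (τ : ℝ) :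
    truncIntegral c n (c * (n + τ)) =
      if 0 ≤ τ then ENNReal.ofReal (profile n τ) else 0 := by
  induction n generalizing τ with
  | zero =>
    have h : 0 ≤ c * τ ↔ 0 ≤ τ := mul_nonneg_iff_of_pos_left hc
    simp [truncIntegral, leInd, profile, h, volume_pi, Measure.pi_empty_univ]
  | succ n ih =>
    rw [truncIntegral_succ hc, lintegral_mul_left_real hc
      (by have := measurable_truncIntegral c n; fun_prop),
      ← lintegral_add_left_eq_self _ ((n : ℝ) + 1)]
    have hpt : ∀ u : ℝ, ENNReal.ofReal (c * ((n : ℝ) + 1 + u))⁻¹ *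
        leInd (c * ((n : ℝ) + 1 + u)) (c * ((n + 1 : ℕ) + τ)) *
        truncIntegral c n (c * ((n : ℝ) + 1 + u) - c) =
        (Set.Icc 0 τ).indicator (fun u => ENNReal.ofReal
          (c⁻¹ * (((n : ℝ) + 1)⁻¹ * (((n : ℝ) + 1) / ((n : ℝ) + 1 + |u|) * profile n u)))) u := by
      intro u
      have e : c * ((n : ℝ) + 1 + u) - c = c * (n + u) := by ring
      have e2 : leInd (c * ((n : ℝ) + 1 + u)) (c * ((n + 1 : ℕ) + τ)) = leInd u τ := by
        refine leInd_congr ?_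
        rw [mul_le_mul_iff_of_pos_left hc]
        push_cast
        constructor <;> intro h <;> linarith
      rw [e, e2, ih, leInd, Set.indicator_apply]
      by_cases h0 : 0 ≤ u <;> by_cases h1 : u ≤ τ
      · rw [if_pos h1, if_pos h0, if_pos ⟨h0, h1⟩, mul_one,
          ← ENNReal.ofReal_mul (by positivity), abs_of_nonneg h0]
        congr 1
        have : (n : ℝ) + 1 + u ≠ 0 := by positivity
        field_simp
      · rw [if_neg h1, if_neg (fun h : u ∈ Set.Icc 0 τ => h1 h.2)]; simp
      · rw [if_neg h0, if_neg (fun h : u ∈ Set.Icc 0 τ => h0 h.1)]; simp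
      · rw [if_neg h0, if_neg (fun h : u ∈ Set.Icc 0 τ => h0 h.1)]; simp
    simp only [hpt]
    rw [lintegral_indicator measurableSet_Icc]
    split_ifs with hτ
    · rw [lintegral_Icc_ofReal hτ, intervalIntegral.integral_const_mul,
        intervalIntegral.integral_const_mul]
      · change _ * (_ * ENNReal.ofReal (c⁻¹ * (((n : ℝ) + 1)⁻¹ * profile (n + 1) τ))) = _
        rw [← ENNReal.ofReal_mul hc.le, ← ENNReal.ofReal_natCast,
          ← ENNReal.ofReal_mul (by positivity)]
        congr 1
        push_cast
        field_simp
      · refine Continuous.continuousOn ?_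
        exact continuous_const.mul (continuous_const.mul
          ((continuous_const.div (by fun_prop) fun t => by positivity).mul (continuous_profile n)))
      · intro u hu
        have := profile_nonneg n hu.1
        positivity
    · rw [Set.Icc_eq_empty hτ]; simp

lemma lintegral_invTrunc_mul {c : ℝ} (hc : 0 < c) (n : ℕ) :
    ∫⁻ x : Fin n → ℝ, invTrunc c (1 - ∑ i, x i) * ∏ i, invTrunc c (x i) =
      (n + 1 : ℕ) * truncIntegral c n (1 - c) := by
  have hterm : ∀ j : Fin n, ∫⁻ x : Fin n → ℝ,
      ENNReal.ofReal (x j) * (invTrunc c (1 - ∑ i, x i) * ∏ i, invTrunc c (x i)) =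
      truncIntegral c n (1 - c) := by
    intro j
    obtain _ | n := n
    · exact j.elim0
    rw [truncIntegral, lintegral_insertNth j (by fun_prop), lintegral_insertNth j (by fun_prop)]
    refine lintegral_congr fun z => ?_
    -- This reflection exchanges xⱼ with x₀ = 1 - ∑ xᵢ, so the term in which xⱼ is cancelled equals
    -- the one in which x₀ is.
    rw [← lintegral_sub_left_eq_self _ (1 - ∑ i, z i)]
    refine lintegral_congr fun t => ?_
    simp only [Fin.sum_univ_succAbove _ j, Fin.prod_univ_succAbove _ j, Fin.insertNth_apply_same,
      Fin.insertNth_apply_succAbove]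
    have e : 1 - (1 - ∑ i, z i - t + ∑ i, z i) = t := by ring
    have e2 : leInd (t + ∑ i, z i) (1 - c) = leInd c (1 - ∑ i, z i - t) :=
      leInd_congr (by constructor <;> intro h <;> linarith)
    rw [e, e2, ← ofReal_mul_invTrunc hc]
    ring
  calc _ = ∫⁻ x : Fin n → ℝ, ((∏ i, invTrunc c (x i)) * leInd (∑ i, x i) (1 - c) +
        ∑ j, ENNReal.ofReal (x j) * (invTrunc c (1 - ∑ i, x i) * ∏ i, invTrunc c (x i))) := by
        refine lintegral_congr fun x => ?_
        have e2 : leInd (∑ i, x i) (1 - c) = leInd c (1 - ∑ i, x i) :=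
          leInd_congr (by constructor <;> intro h <;> linarith)
        rw [e2, ← ofReal_mul_invTrunc hc, ← Finset.sum_mul]
        by_cases h0 : invTrunc c (1 - ∑ i, x i) * ∏ i, invTrunc c (x i) = 0
        · rw [h0, mul_zero, add_zero, mul_comm, mul_assoc, h0, mul_zero]
        · obtain ⟨h1, h2⟩ := mul_ne_zero_iff.1 h0
          rw [Finset.prod_ne_zero_iff] at h2
          have hx : ∀ i, 0 ≤ x i := fun i =>
            hc.le.trans (le_of_invTrunc_ne_zero (h2 i (Finset.mem_univ i)))
          have hx0 := hc.le.trans (le_of_invTrunc_ne_zero h1)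
          have hsum : ENNReal.ofReal (1 - ∑ i, x i) + ∑ i, ENNReal.ofReal (x i) = 1 := by
            rw [← ENNReal.ofReal_sum_of_nonneg (fun i _ => hx i),
              ← ENNReal.ofReal_add hx0 (Finset.sum_nonneg fun i _ => hx i)]
            simp
          conv_lhs => rw [← one_mul (invTrunc c (1 - ∑ i, x i) * ∏ i, invTrunc c (x i)), ← hsum]
          ring
    _ = _ := by
        rw [lintegral_add_left (by fun_prop), lintegral_finsetSum _ (fun j _ => by fun_prop)]
        simp only [hterm]
        rw [truncIntegral]
        push_cast
        simp [add_mul, add_comm]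

lemma lintegral_stdSimplex (n : ℕ) (S : ℝ) :
    ∫⁻ x : Fin n → ℝ, (∏ i, leInd 0 (x i)) * leInd (∑ i, x i) S =
      if 0 ≤ S then ENNReal.ofReal (S ^ n / n.factorial) else 0 := by
  induction n generalizing S with
  | zero => simp [leInd, volume_pi, Measure.pi_empty_univ]
  | succ n ih =>
    rw [lintegral_insertNth 0 (by fun_prop), lintegral_lintegral_swap]
    · have hpt : ∀ t : ℝ, ∫⁻ z : Fin n → ℝ, (∏ i, leInd 0 (Fin.insertNth (α := fun _ => ℝ) 0 t z i)) *
          leInd (∑ i, Fin.insertNth (α := fun _ => ℝ) 0 t z i) S =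
          (Set.Icc 0 S).indicator (fun t => ENNReal.ofReal ((S - t) ^ n / n.factorial)) t := by
        intro t
        have h1 : ∀ z : Fin n → ℝ, (∏ i, leInd 0 (Fin.insertNth (α := fun _ => ℝ) 0 t z i)) *
          leInd (∑ i, Fin.insertNth (α := fun _ => ℝ) 0 t z i) S =
            leInd 0 t * ((∏ i, leInd 0 (z i)) * leInd (∑ i, z i) (S - t)) := by
          intro z
          simp only [Fin.sum_univ_succAbove _ 0, Fin.prod_univ_succAbove _ 0,
            Fin.insertNth_apply_same, Fin.insertNth_apply_succAbove]
          rw [leInd_congr (a := t + ∑ i, z i) (b := S) (a' := ∑ i, z i) (b' := S - t)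
            (by constructor <;> intro h <;> linarith)]
          ring
        simp only [h1]
        rw [lintegral_const_mul _ (by fun_prop), ih, Set.indicator_apply, leInd]
        by_cases h0 : 0 ≤ t <;> by_cases h2 : t ≤ S <;> simp [h0, h2]
      simp only [hpt]
      rw [lintegral_indicator measurableSet_Icc]
      split_ifs with hS
      · rw [lintegral_Icc_ofReal hS (by fun_prop)]
        · congr 1
          rw [intervalIntegral.integral_div,
            intervalIntegral.integral_comp_sub_left (fun t => t ^ n) S, integral_pow]
          push_cast [Nat.factorial_succ]
          simp
          field_simp
        · intro t ht
          have : 0 ≤ S - t := by linarith [ht.2]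
          positivity
      · rw [Set.Icc_eq_empty hS]; simp
    · have := measurable_insertNth (n := n) 0
      refine Measurable.aemeasurable ?_
      simp only [Function.uncurry_def]
      fun_prop

/-! ### The polar of the standard simplex -/

lemma convex_stdSimplex (n : ℕ) : Convex ℝ (stdSimplex n) := by
  intro x hx y hy a b ha hb hab
  have hor : 0 < a ∨ 0 < b := by
    by_contra! h
    linarith
  refine ⟨fun i => ?_, ?_⟩
  · simp only [PiLp.add_apply, PiLp.smul_apply, smul_eq_mul]
    have h1 := hx.1 i
    have h2 := hy.1 i
    rcases hor with h | h
    · exact add_pos_of_pos_of_nonneg (by positivity) (by positivity)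
    · exact add_pos_of_nonneg_of_pos (by positivity) (by positivity)
  · simp only [PiLp.add_apply, PiLp.smul_apply, smul_eq_mul, Finset.sum_add_distrib,
      ← Finset.mul_sum]
    have h1 := hx.2
    have h2 := hy.2
    rcases hor with h | h <;> nlinarith

lemma isOpen_stdSimplex (n : ℕ) : IsOpen (stdSimplex n) := by
  have h : stdSimplex n = (⋂ i, {x : E n | 0 < x i}) ∩ {x | ∑ i, x i < 1} := by
    ext x; simp [stdSimplex]
  rw [h]
  refine (isOpen_iInter_of_finite fun i => ?_).inter ?_
  · exact isOpen_lt continuous_const (by fun_prop)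
  · exact isOpen_lt (by fun_prop) continuous_const

lemma stdBarycenter_mem (n : ℕ) : stdBarycenter n ∈ stdSimplex n := by
  refine ⟨fun i => ?_, ?_⟩
  · simp only [stdBarycenter]; positivity
  · simp only [stdBarycenter, Finset.sum_const, Finset.card_univ, Fintype.card_fin, nsmul_eq_mul,
      mul_one_div]
    rw [div_lt_one (by positivity)]
    linarith

lemma closure_stdSimplex (n : ℕ) :
    closure (stdSimplex n) = {x : E n | (∀ i, 0 ≤ x i) ∧ ∑ i, x i ≤ 1} := by
  apply Set.Subset.antisymm
  · refine closure_minimal (fun x hx => ⟨fun i => (hx.1 i).le, hx.2.le⟩) ?_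
    have h : {x : E n | (∀ i, 0 ≤ x i) ∧ ∑ i, x i ≤ 1} =
        (⋂ i, {x : E n | 0 ≤ x i}) ∩ {x | ∑ i, x i ≤ 1} := by
      ext x; simp
    rw [h]
    refine (isClosed_iInter fun i => ?_).inter ?_
    · exact isClosed_le continuous_const (by fun_prop)
    · exact isClosed_le (by fun_prop) continuous_const
  · rintro x ⟨h0, h1⟩
    have hb := stdBarycenter_mem n
    have hsub : openSegment ℝ (stdBarycenter n) x ⊆ stdSimplex n := by
      rintro _ ⟨a, b, ha, hb', hab, rfl⟩
      refine ⟨fun i => ?_, ?_⟩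
      · simp only [PiLp.add_apply, PiLp.smul_apply, smul_eq_mul]
        have h1 := hb.1 i
        have h2 := h0 i
        exact add_pos_of_pos_of_nonneg (by positivity) (by positivity)
      · simp only [PiLp.add_apply, PiLp.smul_apply, smul_eq_mul, Finset.sum_add_distrib,
          ← Finset.mul_sum]
        have h2 := hb.2
        nlinarith
    exact closure_mono hsub (segment_subset_closure_openSegment (right_mem_segment ℝ _ _))

/-- A linear functional is bounded on the simplex by its values at the vertices e_j and 0; these lie
in the closure, to which the polar inequality extends. -/
lemma polarAt_stdSimplex {n : ℕ} (p : E n) :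
    polarAt (stdSimplex n) p =
      {ξ | (∀ j, ξ j - inner ℝ ξ p ≤ 1) ∧ -inner ℝ ξ p ≤ 1} := by
  ext ξ
  constructor
  · intro h
    have hcl : closure (stdSimplex n) ⊆ {x | inner ℝ ξ (x - p) ≤ 1} :=
      closure_minimal h (isClosed_le (by fun_prop) continuous_const)
    rw [closure_stdSimplex] at hcl
    refine ⟨fun j => ?_, ?_⟩
    · have := @hcl (EuclideanSpace.single j 1) ⟨fun i => ?_, ?_⟩
      · simpa [inner_sub_right, EuclideanSpace.inner_single_right] using this
      · simp only [PiLp.single_apply]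
        split_ifs <;> norm_num
      · simp [PiLp.single_apply]
    · have := @hcl 0 ⟨fun i => by simp, by simp⟩
      simpa using this
  · rintro ⟨h1, h0⟩ x ⟨hx, hs⟩
    have hin : inner ℝ ξ x = ∑ i, x i * ξ i := by simp [PiLp.inner_apply]
    have h2 : ∑ i, x i * (ξ i - inner ℝ ξ p) ≤ ∑ i, x i * 1 :=
      Finset.sum_le_sum fun i _ => mul_le_mul_of_nonneg_left (h1 i) (hx i).le
    simp only [mul_sub, Finset.sum_sub_distrib, ← Finset.sum_mul, mul_one] at h2
    rw [inner_sub_right, hin]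
    nlinarith

/-- The closed standard simplex has volume `1 / n!`. -/
lemma volume_closedSimplex (n : ℕ) :
    volume {x : E n | (∀ i, 0 ≤ x i) ∧ ∑ i, x i ≤ 1} = ENNReal.ofReal (1 / n.factorial) := by
  have hm : MeasurableSet {x : Fin n → ℝ | (∀ i, 0 ≤ x i) ∧ ∑ i, x i ≤ 1} := by
    have h : {x : Fin n → ℝ | (∀ i, 0 ≤ x i) ∧ ∑ i, x i ≤ 1} =
        (⋂ i, {x : Fin n → ℝ | 0 ≤ x i}) ∩ {x | ∑ i, x i ≤ 1} := by
      ext x; simp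
    rw [h]
    refine (MeasurableSet.iInter fun i => ?_).inter ?_
    · exact measurableSet_le measurable_const (by fun_prop)
    · exact measurableSet_le (by fun_prop) measurable_const
  have h1 := (PiLp.volume_preserving_ofLp (Fin n)).measure_preimage hm.nullMeasurableSet
  refine h1.trans ?_
  have h2 := lintegral_stdSimplex n 1
  rw [if_pos zero_le_one, one_pow] at h2
  rw [← h2, ← lintegral_indicator_one hm]
  refine lintegral_congr fun x => ?_
  rw [Set.indicator_apply]
  split_ifs with h
  · have h3 : ∀ i, leInd 0 (x i) = 1 := fun i => if_pos (h.1 i)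
    simp only [h3, Finset.prod_const_one, one_mul, Pi.one_apply]
    exact (if_pos h.2).symm
  · symm
    by_contra h'
    obtain ⟨h3, h4⟩ := mul_ne_zero_iff.1 h'
    rw [Finset.prod_ne_zero_iff] at h3
    refine h ⟨fun i => ?_, ?_⟩
    · by_contra h5
      exact h3 i (Finset.mem_univ i) (if_neg h5)
    · by_contra h5
      exact h4 (if_neg h5)

/-- The matrix of `ξ ↦ (p_j (⟨ξ, p⟩ - ξ_j))_j`. -/
def polarMatrix {n : ℕ} (p : E n) : Matrix (Fin n) (Fin n) ℝ :=
  Matrix.diagonal p.ofLp * -(1 + Matrix.replicateCol Unit (fun _ : Fin n => (-1 : ℝ)) *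
    Matrix.replicateRow Unit p.ofLp)

lemma abs_det_polarMatrix {n : ℕ} {p : E n} (hp : p ∈ stdSimplex n) :
    |(polarMatrix p).det| = (1 - ∑ i, p i) * ∏ i, p i := by
  have h0 : 0 < 1 - ∑ i, p i := by linarith [hp.2]
  have h1 : 0 < ∏ i, p i := Finset.prod_pos fun i _ => hp.1 i
  rw [polarMatrix, Matrix.det_mul, Matrix.det_diagonal, Matrix.det_neg,
    Matrix.det_one_add_replicateCol_mul_replicateRow, abs_mul, abs_mul, abs_pow, abs_neg, abs_one,
    one_pow, one_mul, abs_of_pos h1, mul_comm]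
  congr 1
  have : 1 + p.ofLp ⬝ᵥ (fun _ => (-1 : ℝ)) = 1 - ∑ i, p i := by
    simp [dotProduct, sub_eq_add_neg]
  rw [this, abs_of_pos h0]

lemma polarMatrix_apply {n : ℕ} (p ξ : E n) (j : Fin n) :
    Matrix.toEuclideanLin (polarMatrix p) ξ j = p j * (inner ℝ ξ p - ξ j) := by
  have hin : inner ℝ ξ p = ∑ i, p i * ξ i := by simp [PiLp.inner_apply]
  have hentry : ∀ i, polarMatrix p j i = p j * (p i - if j = i then 1 else 0) := by
    intro i
    rw [polarMatrix, Matrix.diagonal_mul]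
    simp only [Matrix.neg_apply, Matrix.add_apply, Matrix.one_apply, Matrix.mul_apply,
      Matrix.replicateCol_apply, Matrix.replicateRow_apply, Finset.univ_unique, Finset.sum_singleton]
    ring
  rw [hin, Matrix.toLpLin_apply]
  simp only [Matrix.mulVec, dotProduct, hentry, mul_assoc, sub_mul, ← Finset.mul_sum,
    Finset.sum_sub_distrib]
  simp

lemma volume_polarAt_stdSimplex {n : ℕ} {p : E n} (hp : p ∈ stdSimplex n) :
    volume (polarAt (stdSimplex n) p) =
      ENNReal.ofReal (1 / n.factorial) *
        ENNReal.ofReal ((1 - ∑ i, p i)⁻¹ * ∏ i, (p i)⁻¹) := by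
  have h0 : 0 < 1 - ∑ i, p i := by linarith [hp.2]
  have h1 : 0 < ∏ i, p i := Finset.prod_pos fun i _ => hp.1 i
  have hdet : LinearMap.det (Matrix.toEuclideanLin (polarMatrix p)) = (polarMatrix p).det := by
    rw [Matrix.toEuclideanLin, Matrix.toLpLin_eq_toLin, LinearMap.det_toLin]
  -- The point p + `polarMatrix p` ξ has barycentric coordinates pⱼ (1 - ξⱼ + ⟨ξ, p⟩) and (1 - ∑
  -- pᵢ)(1 + ⟨ξ, p⟩), each a positive multiple of the slack in one polar inequality.
  have hset : polarAt (stdSimplex n) p = Matrix.toEuclideanLin (polarMatrix p) ⁻¹'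
      ((fun x => p + x) ⁻¹' {x : E n | (∀ i, 0 ≤ x i) ∧ ∑ i, x i ≤ 1}) := by
    rw [polarAt_stdSimplex]
    ext ξ
    simp only [Set.mem_preimage, Set.mem_ofPred_eq, PiLp.add_apply, polarMatrix_apply]
    have hin : ∑ i, p i * ξ i = inner ℝ ξ p := by simp [PiLp.inner_apply]
    refine and_congr (forall_congr' fun j => ?_) ?_
    · have e : p j + p j * (inner ℝ ξ p - ξ j) = p j * (1 - (ξ j - inner ℝ ξ p)) := by ring
      rw [e, mul_nonneg_iff_of_pos_left (hp.1 j), sub_nonneg]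
    · simp only [mul_sub, Finset.sum_add_distrib, Finset.sum_sub_distrib, ← Finset.sum_mul, hin]
      rw [← sub_nonneg, ← sub_nonneg (b := _ + _), ← mul_nonneg_iff_of_pos_left h0]
      refine iff_of_eq (congrArg _ ?_)
      ring
  have hd0 : LinearMap.det (Matrix.toEuclideanLin (polarMatrix p)) ≠ 0 := by
    rw [hdet, ← abs_pos, abs_det_polarMatrix hp]
    positivity
  rw [hset, Measure.addHaar_preimage_linearMap _ hd0, measure_preimage_add, volume_closedSimplex,
    hdet, abs_inv, abs_det_polarMatrix hp, mul_inv, Finset.prod_inv_distrib, mul_comm]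

/-! ### Funk balls of bounded open convex sets -/

lemma exists_mem_frontier {n : ℕ} {K : Set (E n)} (ho : IsOpen K) {p v : E n} (hp : p ∈ K) {T : ℝ}
    (hT : 0 < T) (hpT : p + T • v ∉ closure K) :
    ∃ t, 0 < t ∧ t < T ∧ p + t • v ∈ frontier K := by
  by_contra! hno
  have hcont : Continuous fun t : ℝ => p + t • v := by fun_prop
  have h := (isPreconnected_Icc (a := (0 : ℝ)) (b := T)) _ _ (ho.preimage hcont)
    (isClosed_closure.isOpen_compl.preimage hcont) ?_ ⟨0, ⟨le_rfl, hT.le⟩, by simpa using hp⟩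
    ⟨T, ⟨hT.le, le_rfl⟩, hpT⟩
  · obtain ⟨t, -, h1, h2⟩ := h
    exact h2 (subset_closure h1)
  · intro t ht
    by_cases h1 : p + t • v ∈ K
    · exact Or.inl h1
    · refine Or.inr fun h2 => ?_
      have hf : p + t • v ∈ frontier K := by
        rw [ho.frontier_eq]; exact ⟨h2, h1⟩
      rcases ht.1.eq_or_lt with h0 | h0
      · rw [← h0] at h1; exact h1 (by simpa using hp)
      · rcases ht.2.eq_or_lt with h3 | h3
        · rw [h3] at h2; exact hpT h2
        · exact hno t h0 h3 hf

lemma exists_notMem_closure {n : ℕ} {K : Set (E n)} (hb : Bornology.IsBounded K) (p : E n)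
    {v : E n} (hv : v ≠ 0) : ∃ T : ℝ, 0 < T ∧ p + T • v ∉ closure K := by
  obtain ⟨r, hr⟩ := hb.closure.subset_closedBall p
  have hv' : 0 < ‖v‖ := norm_pos_iff.2 hv
  refine ⟨(|r| + 1) / ‖v‖, by positivity, fun h => ?_⟩
  have h1 := hr h
  rw [Metric.mem_closedBall, dist_eq_norm, add_sub_cancel_left, norm_smul,
    Real.norm_of_nonneg (by positivity), div_mul_cancel₀ _ hv'.ne'] at h1
  linarith [le_abs_self r]

/-- A frontier point strictly before a point of the closure would lie on an open segment from an
interior point to that point, hence be interior. Boundedness makes the set in the infimum nonempty.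
-/
lemma le_exitTime_iff {n : ℕ} {K : Set (E n)} (hc : Convex ℝ K) (ho : IsOpen K)
    (hb : Bornology.IsBounded K) {p v : E n} (hp : p ∈ K) (hv : v ≠ 0) {T : ℝ} (hT : 0 < T) :
    T ≤ exitTime K p v ↔ p + T • v ∈ closure K := by
  have hbdd : BddBelow {t : ℝ | 0 < t ∧ p + t • v ∈ frontier K} := ⟨0, fun t ht => ht.1.le⟩
  constructor
  · intro h
    by_contra hn
    obtain ⟨t, h0, h1, h2⟩ := exists_mem_frontier ho hp hT hn
    have : exitTime K p v ≤ t := csInf_le hbdd ⟨h0, h2⟩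
    linarith
  · intro h
    obtain ⟨S, hS, hS'⟩ := exists_notMem_closure hb p hv
    obtain ⟨t, h0, -, h2⟩ := exists_mem_frontier ho hp hS hS'
    refine le_csInf ⟨t, h0, h2⟩ fun u hu => ?_
    by_contra! hlt
    rw [ho.frontier_eq] at hu
    refine hu.2.2 ?_
    have h3 := hc.openSegment_interior_closure_subset_interior (ho.interior_eq.symm ▸ hp) h
    rw [ho.interior_eq] at h3
    refine h3 ⟨1 - u / T, u / T, ?_, div_pos hu.1 hT, by ring, ?_⟩
    · rw [sub_pos, div_lt_one hT]; exact hlt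
    · rw [smul_add, smul_smul, div_mul_cancel₀ _ hT.ne', ← add_assoc, ← add_smul]
      simp

/-- If t is the exit time along z - p, the distance is log(t / (t - 1)), and this is at most R
exactly when t ≥ (1 - e^{-R})⁻¹. -/
lemma funkDist_le_iff {n : ℕ} {K : Set (E n)} (hc : Convex ℝ K) (ho : IsOpen K)
    (hb : Bornology.IsBounded K) {p z : E n} (hp : p ∈ K) (hz : z ∈ K) {R : ℝ} (hR : 0 < R) :
    funkDist K p z ≤ R ↔ p + (1 - Real.exp (-R))⁻¹ • (z - p) ∈ closure K := by
  have hE : Real.exp (-R) < 1 := by rw [Real.exp_lt_one_iff]; linarith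
  have hpos : 0 < 1 - Real.exp (-R) := by linarith
  by_cases hpz : p = z
  · subst hpz
    simp [funkDist, hR.le, subset_closure hp]
  have hv : z - p ≠ 0 := sub_ne_zero.2 (Ne.symm hpz)
  rw [← le_exitTime_iff hc ho hb hp hv (inv_pos.2 hpos)]
  set t := exitTime K p (z - p) with ht
  -- Openness of K lets the ray continue inside K beyond z, which is its point at time 1.
  have h1 : 1 < t := by
    have hcont : ContinuousAt (fun s : ℝ => p + s • (z - p)) 1 := by fun_prop
    have hev : ∀ᶠ s : ℝ in 𝓝 1, p + s • (z - p) ∈ K :=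
      hcont.eventually (by simpa using ho.mem_nhds hz)
    obtain ⟨s, hs, hs1⟩ := ((hev.filter_mono (nhdsWithin_le_nhds (s := Set.Ioi 1))).and
      self_mem_nhdsWithin).exists
    have hs1 : 1 < s := hs1
    have : s ≤ t := (le_exitTime_iff hc ho hb hp hv (by linarith)).2 (subset_closure hs)
    linarith
  have hn : 0 < ‖z - p‖ := norm_pos_iff.2 hv
  have hd1 : dist p (exitPoint K p z) = t * ‖z - p‖ := by
    rw [exitPoint, ← ht, dist_comm, dist_eq_norm, add_sub_cancel_left, norm_smul,
      Real.norm_of_nonneg (by linarith)]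
  have hd2 : dist z (exitPoint K p z) = (t - 1) * ‖z - p‖ := by
    have e : p + t • (z - p) - z = (t - 1) • (z - p) := by module
    rw [exitPoint, ← ht, dist_comm, dist_eq_norm, e, norm_smul,
      Real.norm_of_nonneg (by linarith)]
  have ht1 : 0 < t - 1 := by linarith
  rw [funkDist, if_neg hpz, hd1, hd2, mul_div_mul_right _ _ hn.ne',
    Real.log_le_iff_le_exp (by positivity), div_le_iff₀ ht1, inv_le_iff_one_le_mul₀ hpos]
  have hee : Real.exp R * Real.exp (-R) = 1 := by rw [← Real.exp_add]; simp
  have hER := Real.exp_pos R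
  constructor
  · intro h
    by_contra! h'
    have := mul_lt_mul_of_pos_left h' hER
    nlinarith
  · intro h
    have := mul_le_mul_of_nonneg_left h hER.le
    nlinarith

lemma funkBall_eq {n : ℕ} {K : Set (E n)} (hc : Convex ℝ K) (ho : IsOpen K)
    (hb : Bornology.IsBounded K) {p : E n} (hp : p ∈ K) {R : ℝ} (hR : 0 < R) :
    funkBall K p R = {z | z ∈ K ∧ p + (1 - Real.exp (-R))⁻¹ • (z - p) ∈ closure K} := by
  ext z
  exact and_congr_right fun hz => funkDist_le_iff hc ho hb hp hz hR

lemma measurableSet_funkBall {n : ℕ} {K : Set (E n)} (hc : Convex ℝ K) (ho : IsOpen K)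
    (hb : Bornology.IsBounded K) {p : E n} (hp : p ∈ K) {R : ℝ} (hR : 0 < R) :
    MeasurableSet (funkBall K p R) := by
  rw [funkBall_eq hc ho hb hp hR]
  have hcont : Continuous fun z : E n => p + (1 - Real.exp (-R))⁻¹ • (z - p) := by fun_prop
  exact ho.measurableSet.inter (isClosed_closure.preimage hcont).measurableSet

/-! ### Affine invariance -/

lemma det_adjoint {n : ℕ} (L : E n →ₗ[ℝ] E n) :
    LinearMap.det (LinearMap.adjoint L) = LinearMap.det L := by
  let b := EuclideanSpace.basisFun (Fin n) ℝ
  rw [← LinearMap.det_toMatrix b.toBasis, ← LinearMap.det_toMatrix b.toBasis L,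
    LinearMap.toMatrix_adjoint, Matrix.det_conjTranspose]
  simp

/-- Affine bijections commute with homotheties and closures, and `funkBall_eq` describes the ball by
these alone. -/
lemma funkBall_image {n : ℕ} {K : Set (E n)} (hc : Convex ℝ K) (ho : IsOpen K)
    (hb : Bornology.IsBounded K) {p : E n} (hp : p ∈ K) {R : ℝ} (hR : 0 < R)
    (L : E n ≃L[ℝ] E n) (b : E n) :
    funkBall ((fun x => L x + b) '' K) (L p + b) R = (fun x => L x + b) '' funkBall K p R := by
  let T : E n ≃ₜ E n := L.toHomeomorph.trans (Homeomorph.addRight b)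
  have hT : (fun x => L x + b) = T := rfl
  have hcT : Convex ℝ (T '' K) := by
    have h := (hc.linear_image (L : E n →ₗ[ℝ] E n)).translate b
    rw [Set.image_image] at h
    have e : (T '' K) = (fun x => b + (L : E n →ₗ[ℝ] E n) x) '' K :=
      Set.image_congr fun x _ => add_comm (L x) b
    rwa [e]
  have hbT : Bornology.IsBounded (T '' K) := by
    have hk : IsCompact (closure K) := hb.isCompact_closure
    exact (hk.image T.continuous).isBounded.subset (Set.image_mono subset_closure)
  have hcomb : ∀ (c : ℝ) (x : E n), T p + c • (T x - T p) = T (p + c • (x - p)) := by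
    intro c x
    simp only [← hT, map_add, map_smul, map_sub]
    module
  change funkBall ((fun x => L x + b) '' K) (T p) R = _
  rw [hT, funkBall_eq hcT (T.isOpenMap K ho) hbT (Set.mem_image_of_mem T hp) hR,
    funkBall_eq hc ho hb hp hR, ← T.image_closure]
  ext z
  constructor
  · rintro ⟨⟨x, hx, rfl⟩, h⟩
    rw [hcomb, T.injective.mem_set_image] at h
    exact ⟨x, ⟨hx, h⟩, rfl⟩
  · rintro ⟨x, ⟨hx, h⟩, rfl⟩
    refine ⟨⟨x, hx, rfl⟩, ?_⟩
    rw [hcomb, T.injective.mem_set_image]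
    exact h

lemma volume_polarAt_image {n : ℕ} (K : Set (E n)) (p : E n) (L : E n ≃L[ℝ] E n) (b : E n) :
    volume (polarAt ((fun x => L x + b) '' K) (L p + b)) =
      ENNReal.ofReal |LinearMap.det (L : E n →ₗ[ℝ] E n)|⁻¹ * volume (polarAt K p) := by
  have hset : polarAt ((fun x => L x + b) '' K) (L p + b) =
      LinearMap.adjoint (L : E n →ₗ[ℝ] E n) ⁻¹' polarAt K p := by
    ext ξ
    simp only [polarAt, Set.forall_mem_image, Set.mem_preimage]
    refine forall₂_congr fun x hx => ?_
    rw [LinearMap.adjoint_inner_left, add_sub_add_right_eq_sub]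
    simp
  have hd : LinearMap.det (L : E n →ₗ[ℝ] E n) ≠ 0 :=
    (LinearEquiv.isUnit_det' L.toLinearEquiv).ne_zero
  rw [hset, Measure.addHaar_preimage_linearMap _ (by rwa [det_adjoint]), det_adjoint, abs_inv]

/-- The polar volume is divided by |det L| while Lebesgue measure is multiplied by it. -/
lemma holmesThompson_image {n : ℕ} (K : Set (E n)) {U : Set (E n)} (hU : MeasurableSet U)
    (L : E n ≃L[ℝ] E n) (b : E n) :
    holmesThompson ((fun x => L x + b) '' K) ((fun x => L x + b) '' U) = holmesThompson K U := by
  have hd : LinearMap.det (L : E n →ₗ[ℝ] E n) ≠ 0 :=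
    (LinearEquiv.isUnit_det' L.toLinearEquiv).ne_zero
  have hpos := abs_pos.2 hd
  unfold holmesThompson
  rw [lintegral_image_eq_lintegral_abs_det_fderiv_mul volume hU (f := fun x => L x + b)
    (f' := fun _ => (L : E n →L[ℝ] E n))
    (fun x _ => ((L : E n →L[ℝ] E n).hasFDerivAt.add_const b).hasFDerivWithinAt)
    (fun x _ y _ h => L.injective (add_right_cancel h))]
  refine setLIntegral_congr_fun hU fun p _ => ?_
  have hdet : (L : E n →L[ℝ] E n).det = LinearMap.det (L : E n →ₗ[ℝ] E n) := rfl
  rw [volume_polarAt_image, hdet, ENNReal.div_eq_inv_mul, ENNReal.div_eq_inv_mul, mul_left_comm,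
    ← mul_assoc (ENNReal.ofReal _), ← ENNReal.ofReal_mul hpos.le, mul_inv_cancel₀ hpos.ne',
    ENNReal.ofReal_one, one_mul]

/-! ### Simplices as affine images of the standard simplex -/

lemma isBounded_stdSimplex (n : ℕ) : Bornology.IsBounded (stdSimplex n) := by
  refine (Metric.isBounded_iff_subset_closedBall 0).2 ⟨√n, fun x hx => ?_⟩
  rw [Metric.mem_closedBall, dist_zero_right, EuclideanSpace.norm_eq]
  refine Real.sqrt_le_sqrt ?_
  have h1 : ∀ i, x i ≤ 1 := fun i =>
    (Finset.single_le_sum (fun j _ => (hx.1 j).le) (Finset.mem_univ i)).trans hx.2.le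
  calc ∑ i, ‖x i‖ ^ 2 ≤ ∑ _i : Fin n, (1 : ℝ) := by
        refine Finset.sum_le_sum fun i _ => ?_
        rw [Real.norm_of_nonneg (hx.1 i).le]
        exact pow_le_one₀ (hx.1 i).le (h1 i)
    _ = n := by simp

/-- The linear map that sends the `i`-th unit vector to the `i`-th edge of `s` at its vertex `0`. -/
def edgeMap {n : ℕ} (s : Affine.Simplex ℝ (E n) n) : E n →ₗ[ℝ] E n :=
  (Fintype.linearCombination ℝ fun i : Fin n => s.points i.succ - s.points 0) ∘ₗ
    (WithLp.linearEquiv 2 ℝ (Fin n → ℝ)).toLinearMap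

lemma edgeMap_injective {n : ℕ} (s : Affine.Simplex ℝ (E n) n) :
    Function.Injective (edgeMap s) := by
  have h := (affineIndependent_iff_linearIndependent_vsub ℝ s.points 0).1 s.independent
  have h1 : LinearIndependent ℝ fun i : Fin n => s.points i.succ - s.points 0 :=
    h.comp (fun i : Fin n => (⟨i.succ, Fin.succ_ne_zero i⟩ : {x : Fin (n + 1) // x ≠ 0}))
      (fun i j hij => Fin.succ_injective n (Subtype.ext_iff.1 hij))
  exact (linearIndependent_iff_injective_fintypeLinearCombination.1 h1).comp
    (WithLp.linearEquiv 2 ℝ (Fin n → ℝ)).injective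

/-- `edgeMap` as a continuous linear equivalence. -/
def edgeEquiv {n : ℕ} (s : Affine.Simplex ℝ (E n) n) : E n ≃L[ℝ] E n :=
  (LinearEquiv.ofInjectiveEndo (edgeMap s) (edgeMap_injective s)).toContinuousLinearEquiv

lemma edgeEquiv_apply {n : ℕ} (s : Affine.Simplex ℝ (E n) n) (x : E n) :
    edgeEquiv s x = ∑ i, x i • (s.points i.succ - s.points 0) := rfl

lemma affineCombination_eq_edgeEquiv {n : ℕ} (s : Affine.Simplex ℝ (E n) n) {w : Fin (n + 1) → ℝ}
    (hw : ∑ i, w i = 1) :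
    Finset.univ.affineCombination ℝ s.points w =
      edgeEquiv s (WithLp.toLp 2 fun i => w i.succ) + s.points 0 := by
  rw [Finset.affineCombination_eq_weightedVSubOfPoint_vadd_of_sum_eq_one _ _ _ hw (s.points 0),
    Finset.weightedVSubOfPoint_apply, Fin.sum_univ_succ, edgeEquiv_apply]
  simp

lemma interior_eq_image {n : ℕ} (hn : 1 ≤ n) (s : Affine.Simplex ℝ (E n) n) :
    s.interior = (fun x => edgeEquiv s x + s.points 0) '' stdSimplex n := by
  ext z
  constructor
  · rintro ⟨w, hw, hw1, rfl⟩
    rw [affineCombination_eq_edgeEquiv s hw]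
    refine ⟨_, ⟨fun i => (hw1 i.succ).1, ?_⟩, rfl⟩
    rw [Fin.sum_univ_succ] at hw
    have := (hw1 0).1
    simp only
    linarith
  · rintro ⟨x, hx, rfl⟩
    -- Weights in the interior must be strictly below 1; for n = 0 the only weight equals 1, which
    -- is why n ≥ 1 enters.
    have : Nonempty (Fin n) := ⟨⟨0, hn⟩⟩
    have hw : ∑ i, (Fin.cons (1 - ∑ i, x i) x.ofLp : Fin (n + 1) → ℝ) i = 1 := by
      simp [Fin.sum_univ_succ]
    refine ⟨Fin.cons (1 - ∑ i, x i) x.ofLp, hw, fun i => ?_, ?_⟩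
    · refine Fin.cases ?_ (fun i => ?_) i
      · have h2 : 0 < ∑ i, x i := Finset.sum_pos (fun i _ => hx.1 i) Finset.univ_nonempty
        have h3 := hx.2
        simp only [Fin.cons_zero]
        exact ⟨by linarith, by linarith⟩
      · simp only [Fin.cons_succ]
        exact ⟨hx.1 i, (Finset.single_le_sum (fun j _ => (hx.1 j).le)
          (Finset.mem_univ i)).trans_lt hx.2⟩
    · rw [affineCombination_eq_edgeEquiv s hw]
      simp

lemma centroid_eq {n : ℕ} (s : Affine.Simplex ℝ (E n) n) :
    Finset.univ.centroid ℝ s.points = edgeEquiv s (stdBarycenter n) + s.points 0 := by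
  rw [Finset.centroid_def, affineCombination_eq_edgeEquiv]
  · congr 2
    ext i
    simp [stdBarycenter]
  · exact Finset.sum_centroidWeights_eq_one_of_card_ne_zero ℝ _ (by simp)

lemma holmesThompson_simplex {n : ℕ} (hn : 1 ≤ n) (s : Affine.Simplex ℝ (E n) n) {R : ℝ}
    (hR : 0 < R) :
    holmesThompson s.interior (funkBall s.interior (Finset.univ.centroid ℝ s.points) R) =
      holmesThompson (stdSimplex n) (simplexBall n R) := by
  rw [interior_eq_image hn, centroid_eq, funkBall_image (convex_stdSimplex n) (isOpen_stdSimplex n)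
    (isBounded_stdSimplex n) (stdBarycenter_mem n) hR, holmesThompson_image]
  · rfl
  · exact measurableSet_funkBall (convex_stdSimplex n) (isOpen_stdSimplex n)
      (isBounded_stdSimplex n) (stdBarycenter_mem n) hR

/-! ### The volume of a Funk ball of the standard simplex -/

lemma simplexBall_eq (n : ℕ) {R : ℝ} (hR : 0 < R) :
    simplexBall n R = {x : E n | (∀ i, Real.exp (-R) / ((n : ℝ) + 1) ≤ x i) ∧
      ∑ i, x i ≤ 1 - Real.exp (-R) / ((n : ℝ) + 1)} := by
  have hE : Real.exp (-R) < 1 := by rw [Real.exp_lt_one_iff]; linarith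
  have hpos : 0 < 1 - Real.exp (-R) := by linarith
  have hn : (0 : ℝ) < (n : ℝ) + 1 := by positivity
  have hcoord : ∀ y : ℝ, 0 ≤ 1 / ((n : ℝ) + 1) + (1 - Real.exp (-R))⁻¹ * (y - 1 / ((n : ℝ) + 1)) ↔
      Real.exp (-R) / ((n : ℝ) + 1) ≤ y := by
    intro y
    have e : 1 / ((n : ℝ) + 1) + (1 - Real.exp (-R))⁻¹ * (y - 1 / ((n : ℝ) + 1)) =
        (1 - Real.exp (-R))⁻¹ * (y - Real.exp (-R) / ((n : ℝ) + 1)) := by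
      field_simp
      ring
    rw [e, mul_nonneg_iff_of_pos_left (inv_pos.2 hpos), sub_nonneg]
  have hsum : ∀ s : ℝ, (n : ℝ) * (1 / ((n : ℝ) + 1)) +
      (1 - Real.exp (-R))⁻¹ * (s - n * (1 / ((n : ℝ) + 1))) ≤ 1 ↔
      s ≤ 1 - Real.exp (-R) / ((n : ℝ) + 1) := by
    intro s
    have e : 1 - ((n : ℝ) * (1 / ((n : ℝ) + 1)) +
        (1 - Real.exp (-R))⁻¹ * (s - n * (1 / ((n : ℝ) + 1)))) =
        (1 - Real.exp (-R))⁻¹ * (1 - Real.exp (-R) / ((n : ℝ) + 1) - s) := by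
      field_simp
      ring
    rw [← sub_nonneg, e, mul_nonneg_iff_of_pos_left (inv_pos.2 hpos), sub_nonneg]
  rw [simplexBall, funkBall_eq (convex_stdSimplex n) (isOpen_stdSimplex n)
    (isBounded_stdSimplex n) (stdBarycenter_mem n) hR, closure_stdSimplex]
  have hc : 0 < Real.exp (-R) / ((n : ℝ) + 1) := by positivity
  ext x
  have hiff : stdBarycenter n + (1 - Real.exp (-R))⁻¹ • (x - stdBarycenter n) ∈
      {x : E n | (∀ i, 0 ≤ x i) ∧ ∑ i, x i ≤ 1} ↔
      (∀ i, Real.exp (-R) / ((n : ℝ) + 1) ≤ x i) ∧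
        ∑ i, x i ≤ 1 - Real.exp (-R) / ((n : ℝ) + 1) := by
    refine and_congr (forall_congr' fun i => ?_) ?_
    · simpa [stdBarycenter] using hcoord (x i)
    · rw [← hsum]
      simp [stdBarycenter, Finset.sum_add_distrib, ← Finset.mul_sum]
  constructor
  · exact fun h => hiff.1 h.2
  · exact fun h => ⟨⟨fun i => hc.trans_le (h.1 i), by linarith [h.2]⟩, hiff.2 h⟩

lemma measurableSet_simplexBall (n : ℕ) {R : ℝ} (hR : 0 < R) : MeasurableSet (simplexBall n R) :=
  measurableSet_funkBall (convex_stdSimplex n) (isOpen_stdSimplex n) (isBounded_stdSimplex n)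
    (stdBarycenter_mem n) hR

/-- An integral over a ball of the standard simplex as an integral over `ℝⁿ`. -/
lemma setLIntegral_simplexBall {n : ℕ} {R : ℝ} (hR : 0 < R) {f : E n → ENNReal}
    {g : (Fin n → ℝ) → ENNReal} (hg : Measurable g)
    (hfg : ∀ x : E n, (∀ i, Real.exp (-R) / ((n : ℝ) + 1) ≤ x i) →
      ∑ i, x i ≤ 1 - Real.exp (-R) / ((n : ℝ) + 1) → f x = g x.ofLp)
    (hg0 : ∀ x, g x ≠ 0 → (∀ i, Real.exp (-R) / ((n : ℝ) + 1) ≤ x i) ∧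
      ∑ i, x i ≤ 1 - Real.exp (-R) / ((n : ℝ) + 1)) :
    ∫⁻ x in simplexBall n R, f x = ∫⁻ x, g x := by
  rw [← (PiLp.volume_preserving_ofLp (Fin n)).lintegral_comp hg,
    ← lintegral_indicator (measurableSet_simplexBall n hR)]
  refine lintegral_congr fun x => ?_
  classical
  rw [Set.indicator_apply, simplexBall_eq n hR]
  split_ifs with h
  · exact hfg x h.1 h.2
  · by_contra h'
    exact h (hg0 x.ofLp (Ne.symm h'))

lemma prod_invTrunc {n : ℕ} {c : ℝ} (hc : 0 < c) {x : Fin n → ℝ} (hx : ∀ i, c ≤ x i) :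
    ∏ i, invTrunc c (x i) = ENNReal.ofReal (∏ i, (x i)⁻¹) := by
  rw [ENNReal.ofReal_prod_of_nonneg fun i _ => inv_nonneg.2 (hc.le.trans (hx i))]
  exact Finset.prod_congr rfl fun i _ => if_pos (hx i)

lemma le_of_prod_invTrunc_ne_zero {n : ℕ} {c : ℝ} {x : Fin n → ℝ}
    (h : ∏ i, invTrunc c (x i) ≠ 0) (i : Fin n) : c ≤ x i :=
  le_of_invTrunc_ne_zero (Finset.prod_ne_zero_iff.1 h i (Finset.mem_univ i))

/-- For c = e^{-R} / (n + 1), (1 - c) / c = (n + 1) e^R - 1 = n + (n + 1)(e^R - 1), which identifies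
τ. -/
lemma truncIntegral_radius (n : ℕ) (R : ℝ) (hR : 0 < R) :
    truncIntegral (Real.exp (-R) / ((n : ℝ) + 1)) n (1 - Real.exp (-R) / ((n : ℝ) + 1)) =
      ENNReal.ofReal (profile n (((n : ℝ) + 1) * (Real.exp R - 1))) := by
  have hee : Real.exp R * Real.exp (-R) = 1 := by rw [← Real.exp_add]; simp
  have h0 : 0 ≤ ((n : ℝ) + 1) * (Real.exp R - 1) := by
    have : 0 < Real.exp R - 1 := by linarith [Real.one_lt_exp_iff.2 hR]
    positivity
  have e : 1 - Real.exp (-R) / ((n : ℝ) + 1) = Real.exp (-R) / ((n : ℝ) + 1) *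
      (n + ((n : ℝ) + 1) * (Real.exp R - 1)) := by
    field_simp
    linear_combination (-(n : ℝ) - 1) * hee
  rw [e, truncIntegral_eq (by positivity), if_pos h0]

lemma setLIntegral_inv_prod (n : ℕ) {R : ℝ} (hR : 0 < R) :
    ∫⁻ x in simplexBall n R, ENNReal.ofReal (1 / ∏ i, x i) =
      ENNReal.ofReal (profile n (((n : ℝ) + 1) * (Real.exp R - 1))) := by
  have hc : 0 < Real.exp (-R) / ((n : ℝ) + 1) := by positivity
  rw [← truncIntegral_radius n R hR, truncIntegral]
  refine setLIntegral_simplexBall hR (by fun_prop) (fun x h1 h2 => ?_) fun x hx => ?_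
  · rw [prod_invTrunc hc h1, leInd, if_pos h2, mul_one, Finset.prod_inv_distrib, one_div]
  · obtain ⟨h1, h2⟩ := mul_ne_zero_iff.1 hx
    refine ⟨le_of_prod_invTrunc_ne_zero h1, ?_⟩
    by_contra h
    exact h2 (if_neg h)

lemma unitBallVolume_ne_zero (n : ℕ) : unitBallVolume n ≠ 0 :=
  (Metric.measure_ball_pos volume _ one_pos).ne'

lemma unitBallVolume_ne_top (n : ℕ) : unitBallVolume n ≠ ⊤ :=
  measure_ball_lt_top.ne

lemma unitBallVolume_mul_holmesThompson (n : ℕ) {R : ℝ} (hR : 0 < R) :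
    unitBallVolume n * holmesThompson (stdSimplex n) (simplexBall n R) =
      ENNReal.ofReal (((n : ℝ) + 1) / n.factorial *
        profile n (((n : ℝ) + 1) * (Real.exp R - 1))) := by
  have hc : 0 < Real.exp (-R) / ((n : ℝ) + 1) := by positivity
  have h1 : holmesThompson (stdSimplex n) (simplexBall n R) = (unitBallVolume n)⁻¹ *
      ∫⁻ p in simplexBall n R, volume (polarAt (stdSimplex n) p) := by
    rw [holmesThompson, ← lintegral_const_mul' _ _ (ENNReal.inv_ne_top.2 (unitBallVolume_ne_zero n))]
    simp only [ENNReal.div_eq_inv_mul]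
  have h2 : ∫⁻ p in simplexBall n R, volume (polarAt (stdSimplex n) p) =
      ∫⁻ x : Fin n → ℝ, ENNReal.ofReal (1 / n.factorial) *
        (invTrunc (Real.exp (-R) / ((n : ℝ) + 1)) (1 - ∑ i, x i) *
          ∏ i, invTrunc (Real.exp (-R) / ((n : ℝ) + 1)) (x i)) := by
    refine setLIntegral_simplexBall hR (by fun_prop) (fun x h1 h2 => ?_) fun x hx => ?_
    · have hx : x ∈ stdSimplex n := ⟨fun i => hc.trans_le (h1 i), by linarith⟩
      have h3 : Real.exp (-R) / ((n : ℝ) + 1) ≤ 1 - ∑ i, x i := by linarith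
      rw [volume_polarAt_stdSimplex hx, prod_invTrunc hc h1, invTrunc, if_pos h3,
        ENNReal.ofReal_mul (inv_nonneg.2 (by linarith))]
    · obtain ⟨h1, h2⟩ := mul_ne_zero_iff.1 (mul_ne_zero_iff.1 hx).2
      exact ⟨le_of_prod_invTrunc_ne_zero h2, by linarith [le_of_invTrunc_ne_zero h1]⟩
  rw [h1, h2, ← mul_assoc, ENNReal.mul_inv_cancel (unitBallVolume_ne_zero n)
    (unitBallVolume_ne_top n), one_mul, lintegral_const_mul _ (by fun_prop),
    lintegral_invTrunc_mul hc, truncIntegral_radius n R hR, ← ENNReal.ofReal_natCast,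
    ← ENNReal.ofReal_mul (by positivity), ← ENNReal.ofReal_mul (by positivity)]
  congr 1
  push_cast
  ring

lemma profile_radius_nonneg (n : ℕ) {R : ℝ} (hR : 0 < R) :
    0 ≤ profile n (((n : ℝ) + 1) * (Real.exp R - 1)) := by
  refine profile_nonneg n ?_
  have : 0 < Real.exp R - 1 := by linarith [Real.one_lt_exp_iff.2 hR]
  positivity

lemma simplexVolume_eq (n : ℕ) {R : ℝ} (hR : 0 < R) :
    simplexVolume n R = ((n : ℝ) + 1) / n.factorial *
      profile n (((n : ℝ) + 1) * (Real.exp R - 1)) := by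
  have := profile_radius_nonneg n hR
  rw [simplexVolume, unitBallVolume_mul_holmesThompson n hR, ENNReal.toReal_ofReal (by positivity)]

lemma holmesThompson_simplexBall (n : ℕ) {R : ℝ} (hR : 0 < R) :
    holmesThompson (stdSimplex n) (simplexBall n R) =
      ENNReal.ofReal (simplexVolume n R) / unitBallVolume n := by
  rw [simplexVolume_eq n hR, ← unitBallVolume_mul_holmesThompson n hR,
    ENNReal.eq_div_iff (unitBallVolume_ne_zero n) (unitBallVolume_ne_top n)]

lemma inv_prod_nonneg_ae (n : ℕ) {R : ℝ} (hR : 0 < R) :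
    0 ≤ᵐ[volume.restrict (simplexBall n R)] fun x : E n => 1 / ∏ i, x i := by
  refine (ae_restrict_iff' (measurableSet_simplexBall n hR)).2 (Eventually.of_forall fun x hx => ?_)
  exact one_div_nonneg.2 (Finset.prod_nonneg fun i _ => (hx.1.1 i).le)

lemma measurable_inv_prod (n : ℕ) : Measurable fun x : E n => 1 / ∏ i, x i := by
  fun_prop

lemma integrableOn_inv_prod (n : ℕ) {R : ℝ} (hR : 0 < R) :
    IntegrableOn (fun x : E n => 1 / ∏ i, x i) (simplexBall n R) := by
  refine ⟨(measurable_inv_prod n).aestronglyMeasurable, ?_⟩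
  rw [hasFiniteIntegral_iff_ofReal (inv_prod_nonneg_ae n hR), setLIntegral_inv_prod n hR]
  exact ENNReal.ofReal_lt_top

lemma simplexVolume_eq_integral (n : ℕ) {R : ℝ} (hR : 0 < R) :
    simplexVolume n R = ((n : ℝ) + 1) / (n.factorial : ℝ) *
      ∫ x in simplexBall n R, 1 / ∏ i, x i := by
  rw [simplexVolume_eq n hR, integral_eq_lintegral_of_nonneg_ae (inv_prod_nonneg_ae n hR)
    (measurable_inv_prod n).aestronglyMeasurable, setLIntegral_inv_prod n hR,
    ENNReal.toReal_ofReal (profile_radius_nonneg n hR)]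

/-! ### The differential equation and the asymptotics -/

lemma hasDerivAt_simplexVolume {n : ℕ} (hn : 2 ≤ n) {R : ℝ} (hR : 0 < R) :
    HasDerivAt (simplexVolume n)
      (((n : ℝ) + 1) / n * (1 / (1 - Real.exp (-R) / ((n : ℝ) + 1))) *
        simplexVolume (n - 1)
          (R + Real.log (1 + 1 / (n : ℝ) - 1 / (n : ℝ) * Real.exp (-R)))) R := by
  obtain ⟨m, rfl⟩ : ∃ m, n = m + 1 := ⟨n - 1, by omega⟩
  have hE : Real.exp (-R) < 1 := by rw [Real.exp_lt_one_iff]; linarith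
  -- `simplexVolume_eq` requires a positive radius, so the shifted radius must be checked too; its
  -- logarithm is nonnegative because e^{-R} < 1.
  have hR' : 0 < R + Real.log (1 + 1 / ((m + 1 : ℕ) : ℝ)
      - 1 / ((m + 1 : ℕ) : ℝ) * Real.exp (-R)) := by
    have h1 : 0 < 1 / ((m + 1 : ℕ) : ℝ) := by positivity
    have := Real.log_nonneg (x := 1 + 1 / ((m + 1 : ℕ) : ℝ)
      - 1 / ((m + 1 : ℕ) : ℝ) * Real.exp (-R)) (by nlinarith)
    linarith
  have hev : simplexVolume (m + 1) =ᶠ[𝓝 R] fun R => (((m + 1 : ℕ) : ℝ) + 1) / (m + 1).factorial *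
      profile (m + 1) ((((m + 1 : ℕ) : ℝ) + 1) * (Real.exp R - 1)) := by
    filter_upwards [lt_mem_nhds hR] with r hr using simplexVolume_eq (m + 1) hr
  refine (((hasDerivAt_profile_radius m hR).const_mul _).congr_of_eventuallyEq hev).congr_deriv ?_
  rw [Nat.add_sub_cancel, simplexVolume_eq m hR']
  have hf : (m.factorial : ℝ) ≠ 0 := by positivity
  have hm : (m : ℝ) + 1 ≠ 0 := by positivity
  rw [Nat.factorial_succ]
  push_cast
  field_simp

lemma simplexVolume_atTop {n : ℕ} (hn : 1 ≤ n) :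
    ∃ ε : ℝ → ℝ, ε =o[atTop] (fun R : ℝ => R⁻¹) ∧ ∀ R : ℝ, 0 < R →
      simplexVolume n R = ((n + 1).factorial : ℝ) / (n.factorial : ℝ) ^ 2 * R ^ n *
          (1 + n * Real.log ((n : ℝ) + 1) * R⁻¹ + ε R) := by
  obtain ⟨m, rfl⟩ : ∃ m, n = m + 1 := ⟨n - 1, by omega⟩
  refine ⟨fun R => profile (m + 1) ((((m + 1 : ℕ) : ℝ) + 1) * (Real.exp R - 1)) / R ^ (m + 1) - 1 -
    ((m + 1 : ℕ) : ℝ) * Real.log (((m + 1 : ℕ) : ℝ) + 1) * R⁻¹, ?_, fun R hR => ?_⟩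
  · rw [isLittleO_iff_tendsto'
      ((eventually_ne_atTop 0).mono fun R h h' => absurd h' (inv_ne_zero h))]
    have h := (tendsto_profile_radius_atTop m).sub_const
      (((m + 1 : ℕ) : ℝ) * Real.log (((m + 1 : ℕ) : ℝ) + 1))
    rw [sub_self] at h
    refine h.congr' ?_
    filter_upwards [eventually_gt_atTop 0] with R hR
    field_simp
    ring
  · rw [simplexVolume_eq _ hR, Nat.factorial_succ (m + 1)]
    have hf : ((m + 1).factorial : ℝ) ≠ 0 := by positivity
    push_cast
    field_simp
    ring

lemma simplexVolume_zero (n : ℕ) :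
    ∃ ε : ℝ → ℝ, ε =o[𝓝[>] 0] (fun R : ℝ => R ^ (n + 1)) ∧ ∀ R : ℝ, 0 < R →
      simplexVolume n R = ((n : ℝ) + 1) ^ (n + 1) / (n.factorial : ℝ) ^ 2 *
          (R ^ n - (n : ℝ) / 2 * R ^ (n + 1) + ε R) := by
  refine ⟨_, profile_radius_isLittleO_zero n, fun R hR => ?_⟩
  rw [simplexVolume_eq _ hR, add_sub_cancel]
  have hf : (n.factorial : ℝ) ≠ 0 := by positivity
  field_simp
  ring

end FunkSimplex

end

theorem mainTheorem8 (n : ℕ) (hn : 1 ≤ n) :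
    -- the volume of the ball in the Funk geometry of any `n`-simplex
    (∀ (s : Affine.Simplex ℝ (FunkSimplex.E n) n) (R : ℝ), 0 < R →
      FunkSimplex.holmesThompson s.interior
          (FunkSimplex.funkBall s.interior (Finset.univ.centroid ℝ s.points) R) =
        ENNReal.ofReal (FunkSimplex.simplexVolume n R) / FunkSimplex.unitBallVolume n) ∧
    -- the same for the standard simplex, and the integral formula
    (∀ R : ℝ, 0 < R →
      FunkSimplex.holmesThompson (FunkSimplex.stdSimplex n) (FunkSimplex.simplexBall n R) =
        ENNReal.ofReal (FunkSimplex.simplexVolume n R) / FunkSimplex.unitBallVolume n ∧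
      IntegrableOn (fun x : FunkSimplex.E n => 1 / ∏ i, x i) (FunkSimplex.simplexBall n R) ∧
      FunkSimplex.simplexVolume n R =
        ((n : ℝ) + 1) / (n.factorial : ℝ) *
          ∫ x in FunkSimplex.simplexBall n R, 1 / ∏ i, x i) ∧
    -- the recursive differential equation
    (2 ≤ n → ∀ R : ℝ, 0 < R →
      HasDerivAt (FunkSimplex.simplexVolume n)
        (((n : ℝ) + 1) / n * (1 / (1 - Real.exp (-R) / ((n : ℝ) + 1))) *
          FunkSimplex.simplexVolume (n - 1)
            (R + Real.log (1 + 1 / (n : ℝ) - 1 / (n : ℝ) * Real.exp (-R)))) R) ∧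
    -- the asymptotics for large radii
    (∃ ε : ℝ → ℝ, ε =o[atTop] (fun R : ℝ => R⁻¹) ∧ ∀ R : ℝ, 0 < R →
      FunkSimplex.simplexVolume n R =
        ((n + 1).factorial : ℝ) / (n.factorial : ℝ) ^ 2 * R ^ n *
          (1 + n * Real.log ((n : ℝ) + 1) * R⁻¹ + ε R)) ∧
    -- the asymptotics for small radii
    (∃ ε : ℝ → ℝ, ε =o[𝓝[>] 0] (fun R : ℝ => R ^ (n + 1)) ∧ ∀ R : ℝ, 0 < R →
      FunkSimplex.simplexVolume n R =
        ((n : ℝ) + 1) ^ (n + 1) / (n.factorial : ℝ) ^ 2 *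
          (R ^ n - (n : ℝ) / 2 * R ^ (n + 1) + ε R)) := by
  exact ⟨fun s R hR => (FunkSimplex.holmesThompson_simplex hn s hR).trans
      (FunkSimplex.holmesThompson_simplexBall n hR),
    fun R hR => ⟨FunkSimplex.holmesThompson_simplexBall n hR,
      FunkSimplex.integrableOn_inv_prod n hR, FunkSimplex.simplexVolume_eq_integral n hR⟩,
    fun hn2 R hR => FunkSimplex.hasDerivAt_simplexVolume hn2 hR,
    FunkSimplex.simplexVolume_atTop hn, FunkSimplex.simplexVolume_zero n⟩
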